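/- **Setting.** Let $G^n$ be a finite semantic network (a finite set of triples $\langle i,\omega,j\rangle$ over a finite set of resources, with $\texttt{rdf:type}$, $\texttt{rdfs:subClassOf}$ and $\texttt{rdfs:subPropertyOf}$), and let $\Psi$ be a grammar: a finite set of contexts, some of them entry contexts, each with a resource that it resolves to, $\texttt{Is}$ and $\texttt{Not}$ attributes (the next vertex must, respectively must not, be one of the vertices visited a given number of steps ago), and an ordered list of rules. A walker enters at a uniformly random entry context and a uniformly random vertex resolving it, and then executes the rules of its current context in order. $\texttt{IncrCount}$ adds $1$ to the walker's local count of its current vertex (the vertex is *indexed*). $\texttt{SubmitCounts}$ adds the local counts to the global count vector $\pi$ and resets them to $0$. $\texttt{Traverse}$ moves along a uniformly random triple permitted by the edges and attributes in $\Psi$, if there is one, to a new context and a new vertex. $\texttt{Reresolve}$ replaces, with a given probability, the last $m$ steps of the path by a uniformly random legal path through the same contexts. When no rule is left, the walker halts, its local counts are lost, and a new walker enters. Let $\pi'_i=\pi_i/\sum_j\pi_j$ be the normalized global counts. A path of the walker without halts is *grammatically correct* if it starts at an entry context or at a context with a $\texttt{SubmitCounts}$ rule, ends at a context with a $\texttt{SubmitCounts}$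 rule, and some $\texttt{IncrCount}$ rule is executed on it; these paths form $G^{\psi+}$. The state of the walker consists of its current vertex and context, the rule to be executed next, and the part of its recent history that the grammar can consult; a state is recurrent if the walker can get to it and can return to it from wherever it can get afterwards. The *implied network* $G^{\pi}$ has as vertices those indexed in recurrent states. It is obtained by contracting the states at which nothing is indexed: the weight from an indexing state $x$ to an indexing state $y$ is the sum, over all paths from $x$ to $y$ that index nothing in between, of the products of the branch probabilities. The weight $A_{ij}$ from a vertex $i$ to a vertex $j$ is the total weight from a state indexing $i$ to the states indexing $j$. If this depends on the state in which $i$ is indexed, it is averaged over these states according to the stationary law $\nu$ of the contracted network on the recurrent indexing states. **Theorem.** Suppose that the region of recurrent states is strongly connected, that the walker does not halt in it, and that in it vertices are indexed and counts are submitted. Suppose that all grammatically correct paths between consecutively indexed vertices have the same length $L$ (number of traversals). Then: 1. Almost surely, from some time on, any two consecutive increments are exactly $L$ traversals apart, so that contracting the non-indexed vertices does not affect the relative timing. 2. The contracted network is a Markov chain with a unique stationary law $\nu$ on the recurrent indexing states, and the rows of $A\ge 0$ sum to $1$. 3. The normalized counts converge almost surely to a positive probability vector $\pi'$ on the vertices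 of $G^{\pi}$, and $\pi'$ is the primary (Perron) eigenvector of $G^{\pi}$: $\sum_i\pi'_iA_{ij}=\lambda\pi'_j$ for all $j$, where $\lambda$ is an eigenvalue of $A$ that is greatest in modulus among all complex eigenvalues, and every real vector satisfying this equation is a multiple of $\pi'$. -/

import Mathlib

open scoped NNReal ENNReal Topology

noncomputable section

namespace GrammarWalk

/-! ### Semantic networks and grammars -/

/-- A semantic network: a finite list of triples (subject, predicate, object) over a set `R` of
resources, with the three RDF(S) predicates that carry the ontology. -/
structure SemanticNetwork (R : Type*) where
  triples : Finset (R × R × R)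
  rdfType : R
  subClassOf : R
  subPropertyOf : R

/-- `b` is the resource `z`, or an instance of the class `z`, with type inheritance. -/
def SemanticNetwork.IsInstance {R : Type*} (N : SemanticNetwork R) (b z : R) : Prop :=
  b = z ∨ ∃ c, (b, N.rdfType, c) ∈ N.triples ∧
    Relation.ReflTransGen (fun c d => (c, N.subClassOf, d) ∈ N.triples) c z

/-- The predicate `p` is `w` or a subproperty of `w`. -/
def SemanticNetwork.IsSubProperty {R : Type*} (N : SemanticNetwork R) (p w : R) : Prop :=
  Relation.ReflTransGen (fun a b => (a, N.subPropertyOf, b) ∈ N.triples) p w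

/-- An edge of a `Traverse` rule: an out-edge (`out = true`, followed from subject to object) or an
in-edge (`out = false`, followed from object to subject), its predicate, and the context at its
other end. -/
structure Edge (R C : Type*) where
  out : Bool
  pred : R
  target : C

/-- The rules that a context can hold. `reresolve d hd m obeysIs obeysNot`: with probability `d`
recalculate the path since `m` steps ago, respecting the kinds of attributes indicated. -/
inductive Rule (R C : Type*) where
  | incrCount
  | submitCounts
  | traverse (edges : Finset (Edge R C))
  | reresolve (d : ℝ≥0) (hd : d ≤ 1) (m : ℕ) (obeysIs obeysNot : Bool)

/-- How many steps back a rule rewrites the path. -/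
def Rule.lookback {R C : Type*} : Rule R C → ℕ
  | .reresolve _ _ m _ _ => m
  | _ => 0

/-- A grammar with contexts `C`: the entry contexts, the resource each context is for, the step
numbers of its `Is` and of its `Not` attributes, and its ordered sequence of rules. -/
structure Grammar (R C : Type*) where
  entry : Finset C
  resource : C → R
  isSteps : C → Finset ℕ
  notSteps : C → Finset ℕ
  rules : C → List (Rule R C)

/-- The number of most recent visits that the rules and attributes can ever consult:
a re-resolution rewrites `m + 1` visits, and the attributes of the oldest of them look at most
`m' + 1` visits further back. -/
def Grammar.memory {R C : Type*} [Fintype C] (Ψ : Grammar R C) : ℕ :=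
  (Finset.univ.sup fun c => max ((Ψ.isSteps c).sup id) ((Ψ.notSteps c).sup id)) +
    (Finset.univ.sup fun c => ((Ψ.rules c).map Rule.lookback).foldr max 0) + 2

/-! ### The walker -/

/-- One visit in the history of a walker: the vertex, the context that it resolves, and (except at
the entry) the predicate of the triple used to get there, the predicate named by the grammar, and
the direction (`true` for subject to object). -/
abbrev Visit (R C : Type*) := R × C × Option (R × R × Bool)

def Visit.vertex {R C : Type*} (v : Visit R C) : R := v.1

def Visit.context {R C : Type*} (v : Visit R C) : C := v.2.1

def Visit.via {R C : Type*} (v : Visit R C) : Option (R × R × Bool) := v.2.2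

/-- The state of a walker. `none`: a new walker, not yet entered. `some (h, k)`: the recent history
is `h`, latest visit first, and the next rule to execute is rule number `k` (from `0`) of
the current context. -/
abbrev State (R C : Type*) := Option (List (Visit R C) × ℕ)

/-- The current vertex. -/
def State.vertex {R C : Type*} (s : State R C) : Option R :=
  s.bind fun p => p.1.head?.map Visit.vertex

/-- The current context. -/
def State.context {R C : Type*} (s : State R C) : Option C :=
  s.bind fun p => p.1.head?.map Visit.context

/-- The rule about to be executed; there is none when the walker halts. -/
def State.rule {R C : Type*} (Ψ : Grammar R C) (s : State R C) : Option (Rule R C) :=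
  s.bind fun p => p.1.head?.bind fun v => (Ψ.rules v.context)[p.2]?

/-- The walker is about to increment its local count of the current vertex. -/
def IsIncr {R C : Type*} (Ψ : Grammar R C) (s : State R C) : Prop :=
  s.rule Ψ = some .incrCount

/-- The walker is about to submit its local counts. -/
def IsSubmit {R C : Type*} (Ψ : Grammar R C) (s : State R C) : Prop :=
  s.rule Ψ = some .submitCounts

/-- The walker has just arrived at its current vertex (by entering or by a traversal). -/
def IsArrival {R C : Type*} (s : State R C) : Prop :=
  ∃ h, s = some (h, 0)

section Walker

variable {R C : Type*} (N : SemanticNetwork R) (Ψ : Grammar R C)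

/-- The vertex `b` may resolve the context `c` after the history `h` (latest visit first). The `Is`
attributes require `b` to be one of the vertices they point at, if they point at any; the `Not`
attributes forbid the vertices they point at. -/
def Admissible (h : List (Visit R C)) (c : C) (b : R) (obeysIs obeysNot : Bool) : Prop :=
  N.IsInstance b (Ψ.resource c) ∧
  (obeysIs = true →
    (∀ m ∈ Ψ.isSteps c, h[m]? = none) ∨ ∃ m ∈ Ψ.isSteps c, ∃ v, h[m]? = some v ∧ v.vertex = b) ∧
  (obeysNot = true → ∀ m ∈ Ψ.notSteps c, ∀ v, h[m]? = some v → v.vertex ≠ b)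

/-- The end of the triple `τ` at which the edge `y` is left. -/
def Edge.near (y : Edge R C) (τ : R × R × R) : R := if y.out then τ.1 else τ.2.2

/-- The end of the triple `τ` at which the edge `y` arrives. -/
def Edge.far (y : Edge R C) (τ : R × R × R) : R := if y.out then τ.2.2 else τ.1

/-- The edge `y` permits traversing the triple `τ` from the vertex `a` after the history `h`. -/
def Permits (h : List (Visit R C)) (a : R) (y : Edge R C) (τ : R × R × R) : Prop :=
  y.near τ = a ∧ N.IsSubProperty τ.2.1 y.pred ∧ Admissible N Ψ h y.target (y.far τ) true true

open scoped Classical in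
/-- The triples that a `Traverse` rule with edges `E` permits from the vertex `a`. -/
def legalTriples (h : List (Visit R C)) (a : R) (E : Finset (Edge R C)) : Finset (R × R × R) :=
  N.triples.filter fun τ => ∃ y ∈ E, Permits N Ψ h a y τ

open scoped Classical in
/-- The edges of `E` that permit the triple `τ`. -/
def legalEdges (h : List (Visit R C)) (a : R) (E : Finset (Edge R C)) (τ : R × R × R) :
    Finset (Edge R C) :=
  E.filter fun y => Permits N Ψ h a y τ

/-- `q` may replace the visit `t` when the newly chosen visits before it are `qs` (latest first) and
the unchanged history before those is `old`. -/
def Replaces (obeysIs obeysNot : Bool) (old qs : List (Visit R C)) (t q : Visit R C) : Prop :=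
  q.context = t.context ∧ Admissible N Ψ (qs ++ old) q.context q.vertex obeysIs obeysNot ∧
  match qs with
  | [] => q.via = t.via
  | p :: _ => ∃ ω ω' w d, t.via = some (ω', w, d) ∧ q.via = some (ω, w, d) ∧
      N.IsSubProperty ω w ∧
      (if d then (p.vertex, ω, q.vertex) else (q.vertex, ω, p.vertex)) ∈ N.triples

open scoped Classical in
/-- The legal re-resolutions of a path (latest visit first), given the history `old` before it: the
paths in the network with the same contexts, grammar predicates and directions. -/
def reresolutions [Fintype R] [Fintype C] (obeysIs obeysNot : Bool) (old : List (Visit R C)) :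
    List (Visit R C) → Finset (List (Visit R C))
  | [] => {[]}
  | t :: ts => (reresolutions obeysIs obeysNot old ts).biUnion fun qs =>
      (Finset.univ.filter fun q => Replaces N Ψ obeysIs obeysNot old qs t q).image (· :: qs)

open scoped Classical in
/-- The vertices at which a walker can enter at the context `c`. -/
def entryVertices [Fintype R] (c : C) : Finset R :=
  Finset.univ.filter fun i => N.IsInstance i (Ψ.resource c)

open scoped Classical in
/-- A uniformly random element of `S` is handed to `f`; `z` is used when `S` is empty. -/
def chooseFrom {α β : Type*} (S : Finset α) (f : α → PMF β) (z : PMF β) : PMF β :=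
  if hS : S.Nonempty then (PMF.uniformOfFinset S hS).bind f else z

/-- Executing a `Traverse` rule with edges `E` at the latest visit `v` of the history `h`: a uniformly
random permitted triple is followed (and a uniformly random edge among those that permit it).
If there is none, the walker goes on with its next rule. -/
def traverseLaw [Fintype C] (h : List (Visit R C)) (v : Visit R C) (k : ℕ)
    (E : Finset (Edge R C)) : PMF (State R C) :=
  chooseFrom (legalTriples N Ψ h v.vertex E)
    (fun τ => chooseFrom (legalEdges N Ψ h v.vertex E τ)
      (fun y => PMF.pure
        (some ((((y.far τ, y.target, some (τ.2.1, y.pred, y.out)) : Visit R C) :: h).take Ψ.memory,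
          0)))
      (PMF.pure (some (h, k + 1))))
    (PMF.pure (some (h, k + 1)))

/-- A coin that shows `true` with probability `d`. -/
def coin (d : ℝ≥0) (hd : d ≤ 1) : PMF Bool :=
  PMF.ofFintype (fun b => cond b (d : ℝ≥0∞) (1 - d)) (by
    simp [add_tsub_cancel_of_le (ENNReal.coe_le_one_iff.2 hd)])

/-- Executing a `Reresolve` rule at the history `h`. Nothing happens when there is no visit `m` steps
ago or no legal path. -/
def reresolveLaw [Fintype R] [Fintype C] (h : List (Visit R C)) (k : ℕ)
    (d : ℝ≥0) (hd : d ≤ 1) (m : ℕ) (obeysIs obeysNot : Bool) : PMF (State R C) :=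
  if m < h.length then
    (coin d hd).bind fun b =>
      if b then
        chooseFrom (reresolutions N Ψ obeysIs obeysNot (h.drop (m + 1)) (h.take (m + 1)))
          (fun q => PMF.pure (some (q ++ h.drop (m + 1), k + 1)))
          (PMF.pure (some (h, k + 1)))
      else PMF.pure (some (h, k + 1))
  else PMF.pure (some (h, k + 1))

/-- A new walker chooses a uniformly random entry context and then a uniformly random vertex that
resolves it (trying again if there is none). -/
def enterLaw [Fintype R] : PMF (State R C) :=
  chooseFrom Ψ.entry
    (fun c => chooseFrom (entryVertices N Ψ c)
      (fun i => PMF.pure (some ([((i, c, none) : Visit R C)], 0)))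
      (PMF.pure none))
    (PMF.pure none)

/-- The law of the next state: one rule is executed. A walker without a rule to execute halts and is
replaced by a new one. -/
def step [Fintype R] [Fintype C] : State R C → PMF (State R C)
  | none => enterLaw N Ψ
  | some ([], _) => PMF.pure none
  | some (v :: h, k) =>
    match (Ψ.rules v.context)[k]? with
    | none => PMF.pure none
    | some .incrCount => PMF.pure (some (v :: h, k + 1))
    | some .submitCounts => PMF.pure (some (v :: h, k + 1))
    | some (.traverse E) => traverseLaw N Ψ (v :: h) v k E
    | some (.reresolve d hd m obeysIs obeysNot) =>
        reresolveLaw N Ψ (v :: h) k d hd m obeysIs obeysNot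

/-- `X` is the sequence of states of a walker (and of its successors after halts) that obeys the
grammar. -/
structure IsWalk [Fintype R] [Fintype C] {Ω : Type*} [MeasurableSpace Ω]
    (P : MeasureTheory.Measure Ω) (X : ℕ → Ω → State R C) : Prop where
  measurable : ∀ n s, MeasurableSet {ω | X n ω = s}
  start : ∀ᵐ ω ∂P, X 0 ω = none
  law : ∀ (n : ℕ) (s : ℕ → State R C),
    P {ω | ∀ k ≤ n + 1, X k ω = s k} = P {ω | ∀ k ≤ n, X k ω = s k} * step N Ψ (s n) (s (n + 1))

open scoped Classical in
/-- The pair (local counts, global counts) after `n` rule executions along `x`. The local counts are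
lost when the walker halts. -/
def counts (x : ℕ → State R C) : ℕ → (R → ℕ) × (R → ℕ)
  | 0 => (0, 0)
  | n + 1 =>
    let c := counts x n
    if IsIncr Ψ (x n) then (fun i => c.1 i + if (x n).vertex = some i then 1 else 0, c.2)
    else if IsSubmit Ψ (x n) then (0, c.2 + c.1)
    else if x n = none then (0, c.2)
    else c

/-- The normalized global counts. -/
def normalizedCount [Fintype R] (x : ℕ → State R C) (n : ℕ) (i : R) : ℝ :=
  ((counts Ψ x n).2 i : ℝ) / ∑ j, ((counts Ψ x n).2 j : ℝ)

/-! ### The traversed region and grammatically correct paths -/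

variable [Fintype R] [Fintype C]

/-- The walker can get from the state `s` to the state `t`. -/
def Reach (s t : State R C) : Prop :=
  Relation.ReflTransGen (fun a b => step N Ψ a b ≠ 0) s t

/-- The states in which the walker moves in the long run: those it can get to, and to which it can
return from wherever it can get afterwards. -/
def Recurrent (s : State R C) : Prop :=
  Reach N Ψ none s ∧ ∀ t, Reach N Ψ s t → Reach N Ψ t s

/-- The region in which the walker moves in the long run is strongly connected. -/
def StronglyConnected : Prop :=
  ∀ s t, Recurrent N Ψ s → Recurrent N Ψ t → Reach N Ψ s t

/-- In the long run the walker does not halt, and it keeps indexing vertices and submitting its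
counts, so it moves on grammatically correct paths only. -/
def LongRunCorrect : Prop :=
  ¬ Recurrent N Ψ none ∧ (∃ s, Recurrent N Ψ s ∧ IsIncr Ψ s) ∧ ∃ s, Recurrent N Ψ s ∧ IsSubmit Ψ s

/-- `x m, …, x n` is a grammatically correct path of the walker: it starts on arrival at an entry
context or a context with a `SubmitCounts` rule, ends at a context with a `SubmitCounts` rule,
and some `IncrCount` rule is executed on it. -/
def IsCorrectPath (x : ℕ → State R C) (m n : ℕ) : Prop :=
  m ≤ n ∧ Reach N Ψ none (x m) ∧
  (∀ k, m ≤ k → k < n → step N Ψ (x k) (x (k + 1)) ≠ 0) ∧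
  (∀ k, m ≤ k → k ≤ n → x k ≠ none) ∧
  (IsArrival (x m) ∧
    ∃ c, (x m).context = some c ∧ (c ∈ Ψ.entry ∨ Rule.submitCounts ∈ Ψ.rules c)) ∧
  (∃ c, (x n).context = some c ∧ Rule.submitCounts ∈ Ψ.rules c) ∧
  ∃ k, m ≤ k ∧ k ≤ n ∧ IsIncr Ψ (x k)

open scoped Classical in
/-- The number of traversals between times `a` and `b`. -/
def pathLength (x : ℕ → State R C) (a b : ℕ) : ℕ :=
  ((Finset.Ioc a b).filter fun k => IsArrival (x k)).card

/-- At the times `a < b` vertices are indexed, and none is in between. -/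
def ConsecutiveIncr (x : ℕ → State R C) (a b : ℕ) : Prop :=
  a < b ∧ IsIncr Ψ (x a) ∧ IsIncr Ψ (x b) ∧ ∀ k, a < k → k < b → ¬ IsIncr Ψ (x k)

/-- All grammatically correct paths between consecutive indexed vertices have length `L`. -/
def EqualLengths (L : ℕ) : Prop :=
  ∀ x m n, IsCorrectPath N Ψ x m n →
    ∀ a b, m ≤ a → b ≤ n → ConsecutiveIncr Ψ x a b → pathLength x a b = L

/-! ### The implied network -/

open scoped Classical in
/-- The probability that the walker, from `x`, is at the indexing state `y` after `n + 1` rule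
executions, without having been at an indexing state in between. -/
def firstIncr : ℕ → State R C → State R C → ℝ≥0∞
  | 0, x, y => if IsIncr Ψ y then step N Ψ x y else 0
  | n + 1, x, y => ∑' z, if IsIncr Ψ z then 0 else step N Ψ x z * firstIncr n z y

/-- The weight from `x` to `y` after contracting the states at which nothing is indexed: the sum, over
all paths from `x` to `y` without indexing in between, of the products of the branch
probabilities. -/
def contracted (x y : State R C) : ℝ≥0∞ := ∑' n, firstIncr N Ψ n x y

open scoped Classical in
/-- The contracted weight from the state `x` to the indexed vertex `j`. -/
def contractedTo (x : State R C) (j : R) : ℝ≥0∞ :=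
  ∑' y : State R C, if y.vertex = some j then contracted N Ψ x y else 0

/-- `ν` is a stationary law, among the recurrent indexing states, of the contracted network. -/
def IsContractedStationary (ν : PMF (State R C)) : Prop :=
  (∀ s, ν s ≠ 0 → Recurrent N Ψ s ∧ IsIncr Ψ s) ∧ ∀ y, ∑' x, ν x * contracted N Ψ x y = ν y

/-- The vertices of the implied network: those that the walker indexes in the long run. -/
def IndexedVertex : Type _ :=
  {i : R // ∃ s : State R C, Recurrent N Ψ s ∧ IsIncr Ψ s ∧ s.vertex = some i}

instance : Fintype (IndexedVertex N Ψ) :=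
  @Fintype.ofFinite _ (inferInstanceAs (Finite {i : R // ∃ s : State R C,
    Recurrent N Ψ s ∧ IsIncr Ψ s ∧ s.vertex = some i}))

open scoped Classical in
/-- The weighted adjacency matrix of the implied network; the entry `(i, j)` is the probability that
the vertex indexed next after `i` is `j`. The states in which the walker indexes `i` differ in
its grammar context and its memory, and `ν` says how frequent each of them is. -/
def impliedNetwork (ν : PMF (State R C)) :
    Matrix (IndexedVertex N Ψ) (IndexedVertex N Ψ) ℝ := fun i j =>
  ((∑' x : State R C, if x.vertex = some i.1 then ν x * contractedTo N Ψ x j.1 else 0) /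
    ∑' x : State R C, if x.vertex = some i.1 then ν x else 0).toReal

end Walker

/-- `x` is the primary eigenvector of `M`: it belongs to an eigenvalue which is the greatest in
modulus, and it is the only eigenvector of that eigenvalue up to scalars. -/
def IsPrimaryEigenvector {I : Type*} [Fintype I] (M : Matrix I I ℝ) (x : I → ℝ) : Prop :=
  x ≠ 0 ∧ ∃ l : ℝ, M.mulVec x = l • x ∧
    (∀ (c : ℂ) (z : I → ℂ), z ≠ 0 → (M.map Complex.ofReal).mulVec z = c • z → ‖c‖ ≤ l) ∧
    ∀ y : I → ℝ, M.mulVec y = l • y → ∃ a : ℝ, y = a • x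

end GrammarWalk

end

open GrammarWalk

/-!
# Relative frequencies of a grammar-based random walk

The history of a walker is cut off at the memory of the grammar, so the walker is a Markov chain with
finitely many reachable states. From each of them a recurrent state can be reached, and the
recurrent states are strongly connected; hence some indexing state `s₀` is reached from everywhere.
For a finite stochastic matrix `Q` with such a state (`FiniteChain.IsUnichain`), the maximum
principle makes the map `g ↦ g - Q g + g s₀` injective, thus surjective, so that every function is
`f = c + (g - Q g)` with a constant `c`. This Poisson equation yields the stationary law `μ`
(`c = ∑ μ s * f s`), its uniqueness and its support, and it turns sums of `f` along the walk into
martingales with bounded increments. These obey the law of large numbers by a second moment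
estimate (`FiniteChain.tendsto_sum_increments_div`), so time averages of `f` converge to `c`.

It follows that each recurrent state is visited again and again, in particular one that submits. The
walk between two such visits is grammatically correct, which gives the equal timing
(`exists_forall_pathLength_eq`), and the submitted counts are the total counts at the latest
submission up to a bounded error, so their proportions converge (`tendsto_normalizedCount`).

The contracted weights satisfy a first-step decomposition (`contracted_eq`). Their row sums are `1` by
the maximum principle (`tsum_contracted_eq_one`), and conditioning `μ` on indexing gives a stationary
law `ν` for them, because the mass that passes through the other states cancels
(`tsum_stationary_mul_contracted`). The implied network is the contracted chain, lumped along the map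
from states to indexed vertices with the weights `ν` (`impliedNetwork_eq_lump`). Lumping preserves
stochasticity and reachability, and the limit of the normalized counts, the vertex marginal of `ν`,
is stationary for the lumped matrix; so it is the eigenvector to the eigenvalue `1`, which is simple
and greatest in modulus.
-/

namespace FiniteChain

open Finset Filter MeasureTheory

/-! ### Stochastic matrices with a state that is reached from everywhere -/

/-- `Q` is a stochastic matrix, and the state `s₀` can be reached from every state along transitions
of positive probability. -/
structure IsUnichain {S : Type*} [Fintype S] (Q : S → S → ℝ) (s₀ : S) : Prop where
  nonneg : ∀ x y, 0 ≤ Q x y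
  sum_one : ∀ x, ∑ y, Q x y = 1
  reach : ∀ x, Relation.ReflTransGen (fun a b => Q a b ≠ 0) x s₀

namespace IsUnichain

variable {S : Type*} [Fintype S] {Q : S → S → ℝ} {s₀ : S}

/-- Maximum principle: from a maximum of a subharmonic function the chain moves to maxima only. -/
theorem subharmonic_le (h : IsUnichain Q s₀) {g : S → ℝ} (hg : ∀ x, g x ≤ ∑ y, Q x y * g y)
    (x : S) : g x ≤ g s₀ := by
  obtain ⟨m, -, hm⟩ := Finset.exists_max_image univ g ⟨s₀, mem_univ _⟩
  have key : ∀ y, Relation.ReflTransGen (fun a b => Q a b ≠ 0) m y → g y = g m := by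
    intro y hy
    induction hy with
    | refl => rfl
    | @tail b c _ hbc ih =>
      by_contra hne
      have hlt : g c < g m := lt_of_le_of_ne (hm c (mem_univ _)) hne
      have hQ : 0 < Q b c := lt_of_le_of_ne (h.nonneg b c) (Ne.symm hbc)
      have h1 : ∑ y, Q b y * g y < ∑ y, Q b y * g m :=
        Finset.sum_lt_sum
          (fun i _ => mul_le_mul_of_nonneg_left (hm i (mem_univ _)) (h.nonneg b i))
          ⟨c, mem_univ _, mul_lt_mul_of_pos_left hlt hQ⟩
      rw [← Finset.sum_mul, h.sum_one, one_mul] at h1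
      linarith [hg b]
  rw [key s₀ (h.reach m)]
  exact hm x (mem_univ _)

theorem le_superharmonic (h : IsUnichain Q s₀) {g : S → ℝ} (hg : ∀ x, ∑ y, Q x y * g y ≤ g x)
    (x : S) : g s₀ ≤ g x := by
  have := h.subharmonic_le (g := fun x => - g x)
    (fun x => by simpa [Finset.sum_neg_distrib] using hg x) x
  linarith

/-- At a minimum `x` of `g`, the defect `g x - (Q g) x` is not positive. -/
theorem exists_defect_nonpos (h : IsUnichain Q s₀) (g : S → ℝ) :
    ∃ x, g x - ∑ y, Q x y * g y ≤ 0 := by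
  obtain ⟨m, -, hm⟩ := Finset.exists_min_image univ g ⟨s₀, mem_univ _⟩
  refine ⟨m, ?_⟩
  have h1 : ∑ y, Q m y * g m ≤ ∑ y, Q m y * g y :=
    Finset.sum_le_sum fun i _ => mul_le_mul_of_nonneg_left (hm i (mem_univ _)) (h.nonneg m i)
  rw [← Finset.sum_mul, h.sum_one, one_mul] at h1
  linarith

theorem defect_const_eq_zero (h : IsUnichain Q s₀) {g : S → ℝ} {c : ℝ}
    (hg : ∀ x, g x - ∑ y, Q x y * g y = c) : c = 0 := by
  obtain ⟨x, hx⟩ := h.exists_defect_nonpos g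
  obtain ⟨y, hy⟩ := h.exists_defect_nonpos (fun x => - g x)
  have h1 := hg x
  have h2 := hg y
  simp only [mul_neg, Finset.sum_neg_distrib] at hy
  linarith

/-- The Poisson equation `f = c + g - Q g` is solvable. The map `g ↦ g - Q g + g s₀` is injective
by the maximum principle, hence surjective, so that `c = g s₀` can be taken. -/
theorem exists_poisson (h : IsUnichain Q s₀) (f : S → ℝ) :
    ∃ (c : ℝ) (g : S → ℝ), ∀ x, f x = c + (g x - ∑ y, Q x y * g y) := by
  let U : (S → ℝ) →ₗ[ℝ] (S → ℝ) :=
    { toFun := fun g x => g x - ∑ y, Q x y * g y + g s₀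
      map_add' := fun g g' => by
        ext x; simp only [Pi.add_apply, mul_add, Finset.sum_add_distrib]; ring
      map_smul' := fun a g => by
        ext x
        simp only [Pi.smul_apply, smul_eq_mul, RingHom.id_apply, mul_add, mul_sub, Finset.mul_sum]
        congr 2
        exact Finset.sum_congr rfl fun _ _ => by ring }
  have hinj : Function.Injective U := by
    rw [← LinearMap.ker_eq_bot, LinearMap.ker_eq_bot']
    intro g hg
    have hx : ∀ x, g x - ∑ y, Q x y * g y + g s₀ = 0 := fun x => congrFun hg x
    have h0 : - g s₀ = 0 := h.defect_const_eq_zero (g := g) fun x => by linarith [hx x]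
    ext x
    have h1 := h.subharmonic_le (g := g) (fun x => by linarith [hx x]) x
    have h2 := h.le_superharmonic (g := g) (fun x => by linarith [hx x]) x
    simp only [Pi.zero_apply]
    linarith
  obtain ⟨g, hg⟩ := LinearMap.injective_iff_surjective.1 hinj f
  exact ⟨g s₀, g, fun x => by rw [← hg]; simp only [U, LinearMap.coe_mk, AddHom.coe_mk]; ring⟩

/-- A left eigenvector to the eigenvalue `1` annihilates the defects `g - Q g`. -/
theorem sum_stationary_mul_defect {y : S → ℝ} (hy : ∀ t, ∑ x, y x * Q x t = y t) (g : S → ℝ) :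
    ∑ x, y x * (g x - ∑ t, Q x t * g t) = 0 := by
  simp only [mul_sub, Finset.sum_sub_distrib, Finset.mul_sum]
  rw [Finset.sum_comm (f := fun x t => y x * (Q x t * g t)), sub_eq_zero]
  refine Finset.sum_congr rfl fun t _ => ?_
  rw [← hy t, Finset.sum_mul]
  exact Finset.sum_congr rfl fun _ _ => by ring

theorem sum_stationary_mul {y : S → ℝ} (hy : ∀ t, ∑ x, y x * Q x t = y t) {f g : S → ℝ} {c : ℝ}
    (hf : ∀ x, f x = c + (g x - ∑ y, Q x y * g y)) : ∑ x, y x * f x = c * ∑ x, y x := by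
  have := sum_stationary_mul_defect hy g
  simp only [hf, mul_add, Finset.sum_add_distrib, ← Finset.sum_mul]
  rw [this]; ring

/-- A left eigenvector to the eigenvalue `1` is determined by its sum. -/
theorem stationary_unique (h : IsUnichain Q s₀) {y z : S → ℝ} (hy : ∀ t, ∑ x, y x * Q x t = y t)
    (hz : ∀ t, ∑ x, z x * Q x t = z t) (hyz : ∑ x, y x = ∑ x, z x) : y = z := by
  classical
  ext s
  obtain ⟨c, g, hf⟩ := h.exists_poisson (fun x => if x = s then 1 else 0)
  have h1 := sum_stationary_mul hy hf
  have h2 := sum_stationary_mul hz hf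
  simp only [mul_ite, mul_one, mul_zero, Finset.sum_ite_eq', mem_univ, if_true] at h1 h2
  rw [h1, h2, hyz]

/-- The stationary law: its value at `s` is the constant in the Poisson equation for the indicator of
`s`. -/
theorem exists_stationary (h : IsUnichain Q s₀) :
    ∃ μ : S → ℝ, (∀ s, 0 ≤ μ s) ∧ ∑ s, μ s = 1 ∧ (∀ t, ∑ x, μ x * Q x t = μ t) ∧ 0 < μ s₀ ∧
      ∀ f : S → ℝ, ∃ g : S → ℝ, ∀ x, f x = ∑ s, μ s * f s + (g x - ∑ y, Q x y * g y) := by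
  classical
  choose μ G hG using fun s => h.exists_poisson (fun x => if x = s then 1 else 0)
  have hP : ∀ f : S → ℝ, ∃ g : S → ℝ,
      ∀ x, f x = ∑ s, μ s * f s + (g x - ∑ y, Q x y * g y) := by
    intro f
    refine ⟨fun x => ∑ s, f s * G s x, fun x => ?_⟩
    have h1 : f x = ∑ s, f s * (if x = s then 1 else 0) := by simp
    have h2 : ∑ y, Q x y * ∑ s, f s * G s y = ∑ s, f s * ∑ y, Q x y * G s y := by
      simp only [Finset.mul_sum]
      rw [Finset.sum_comm]
      exact Finset.sum_congr rfl fun _ _ => Finset.sum_congr rfl fun _ _ => by ring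
    rw [h2, h1, ← Finset.sum_sub_distrib, ← Finset.sum_add_distrib]
    refine Finset.sum_congr rfl fun s _ => ?_
    rw [hG s x]; ring
  refine ⟨μ, fun s => ?_, ?_, fun t => ?_, ?_, hP⟩
  · obtain ⟨x, hx⟩ := h.exists_defect_nonpos (G s)
    have h1 := hG s x
    have h2 : (0 : ℝ) ≤ if x = s then 1 else 0 := by split_ifs <;> norm_num
    linarith
  · obtain ⟨g, hg⟩ := hP fun _ => 1
    simp only [mul_one] at hg
    have := h.defect_const_eq_zero (g := g) (c := 1 - ∑ s, μ s) fun x => by linarith [hg x]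
    linarith
  · obtain ⟨g, hg⟩ := hP fun x => (if x = t then 1 else 0) - Q x t
    simp only [mul_sub, mul_ite, mul_one, mul_zero, Finset.sum_sub_distrib, Finset.sum_ite_eq',
      mem_univ, if_true] at hg
    have := h.defect_const_eq_zero (g := fun x => (if x = t then 1 else 0) - g x)
      (c := μ t - ∑ x, μ x * Q x t) fun x => by
        have := hg x
        simp only [mul_sub, mul_ite, mul_one, mul_zero, Finset.sum_sub_distrib, Finset.sum_ite_eq',
          mem_univ, if_true]
        linarith
    linarith
  · -- Otherwise `G s₀` is superharmonic with its minimum at `s₀`, where its defect is at least `1`.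
    by_contra hneg
    push Not at hneg
    have hsup : ∀ x, ∑ y, Q x y * G s₀ y ≤ G s₀ x := fun x => by
      have h1 := hG s₀ x
      have h2 : (0 : ℝ) ≤ if x = s₀ then 1 else 0 := by split_ifs <;> norm_num
      linarith
    have hmin := h.le_superharmonic hsup
    have h1 : ∑ y, Q s₀ y * G s₀ s₀ ≤ ∑ y, Q s₀ y * G s₀ y :=
      Finset.sum_le_sum fun i _ => mul_le_mul_of_nonneg_left (hmin i) (h.nonneg s₀ i)
    rw [← Finset.sum_mul, h.sum_one, one_mul] at h1
    have h2 := hG s₀ s₀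
    simp only [if_true] at h2
    linarith

theorem stationary_pos_of_reach (hQ : ∀ x y, 0 ≤ Q x y) {μ : S → ℝ} (h0 : ∀ s, 0 ≤ μ s)
    (hμ : ∀ t, ∑ x, μ x * Q x t = μ t) {s t : S} (hs : 0 < μ s)
    (hst : Relation.ReflTransGen (fun a b => Q a b ≠ 0) s t) : 0 < μ t := by
  induction hst with
  | refl => exact hs
  | @tail b c _ hbc ih =>
    rw [← hμ c]
    exact lt_of_lt_of_le (mul_pos ih (lt_of_le_of_ne (hQ b c) (Ne.symm hbc)))
      (Finset.single_le_sum (f := fun x => μ x * Q x c)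
        (fun x _ => mul_nonneg (h0 x) (hQ x c)) (mem_univ b))

/-- A stationary law does not charge the states that cannot be reached from `s₀`: those that can be
form a closed set, into which no mass may flow. -/
theorem stationary_eq_zero (h : IsUnichain Q s₀) {μ : S → ℝ} (h0 : ∀ s, 0 ≤ μ s)
    (hμ : ∀ t, ∑ x, μ x * Q x t = μ t) {s : S}
    (hs : ¬ Relation.ReflTransGen (fun a b => Q a b ≠ 0) s₀ s) : μ s = 0 := by
  classical
  by_contra hne
  have hpos : 0 < μ s := lt_of_le_of_ne (h0 s) (Ne.symm hne)
  let u : S → ℝ := fun x => if Relation.ReflTransGen (fun a b => Q a b ≠ 0) s₀ x then 0 else 1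
  have hu1 : ∀ x, u x ≤ 1 := fun x => by simp only [u]; split_ifs <;> norm_num
  have hdef : ∀ x, 0 ≤ u x - ∑ y, Q x y * u y := by
    intro x
    by_cases hx : Relation.ReflTransGen (fun a b => Q a b ≠ 0) s₀ x
    · have : ∑ y, Q x y * u y = 0 := Finset.sum_eq_zero fun y _ => by
        by_cases hy : Q x y = 0
        · simp [hy]
        · simp [u, hx.tail hy]
      rw [this]; simp [u, hx]
    · have h1 : ∑ y, Q x y * u y ≤ ∑ y, Q x y :=
        Finset.sum_le_sum fun y _ => mul_le_of_le_one_right (h.nonneg x y) (hu1 y)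
      rw [h.sum_one] at h1
      simp only [u, hx, if_false] at h1 ⊢
      linarith
  have hzero := (Finset.sum_eq_zero_iff_of_nonneg
    (fun x _ => mul_nonneg (h0 x) (hdef x))).1 (sum_stationary_mul_defect hμ u)
  have key : ∀ t, Relation.ReflTransGen (fun a b => Q a b ≠ 0) s t → u t = 1 := by
    intro t ht
    induction ht with
    | refl => simp [u, hs]
    | @tail b c hb hbc ih =>
      by_contra hc
      have hb0 := stationary_pos_of_reach h.nonneg h0 hμ hpos hb
      have h1 := (mul_eq_zero.1 (hzero b (mem_univ _))).resolve_left hb0.ne'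
      have h2 : ∑ y, Q b y * u y < ∑ y, Q b y * 1 :=
        Finset.sum_lt_sum (fun y _ => mul_le_mul_of_nonneg_left (hu1 y) (h.nonneg b y))
          ⟨c, mem_univ _, mul_lt_mul_of_pos_left (lt_of_le_of_ne (hu1 c) hc)
            (lt_of_le_of_ne (h.nonneg b c) (Ne.symm hbc))⟩
      simp only [mul_one, h.sum_one] at h2
      linarith
  have := key s₀ (h.reach s)
  simp [u, Relation.ReflTransGen.refl] at this

end IsUnichain

/-! ### The law of large numbers for finite Markov chains -/

section LLN

variable {S Ω : Type*} [Fintype S] [MeasurableSpace Ω] {P : Measure Ω} [IsProbabilityMeasure P]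
  {Q : S → S → ℝ} {Y : ℕ → Ω → S}

/-- The law of the process at the times up to `n + 1` turns expectations into finite sums over
pairs of a path and a next state. -/
theorem integral_path (hm : ∀ n s, MeasurableSet {ω | Y n ω = s})
    (n : ℕ) (F : (Fin (n + 1) → S) → S → ℝ) :
    Integrable (fun ω => F (fun k => Y k ω) (Y (n + 1) ω)) P ∧
    ∫ ω, F (fun k => Y k ω) (Y (n + 1) ω) ∂P =
      ∑ p : Fin (n + 1) → S, ∑ t, P.real {ω | (∀ k : Fin (n + 1), Y k ω = p k) ∧
        Y (n + 1) ω = t} * F p t := by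
  classical
  let _ : MeasurableSpace S := ⊤
  have : MeasurableSingletonClass S := ⟨fun _ => trivial⟩
  have hY : ∀ n, Measurable (Y n) := fun n => measurable_to_countable' fun s => hm n s
  have hZ : Measurable (fun ω => ((fun k : Fin (n + 1) => Y k ω), Y (n + 1) ω)) :=
    (measurable_pi_lambda (fun ω (k : Fin (n + 1)) => Y k ω) fun k => hY k).prodMk (hY _)
  have hF : Measurable (fun q : (Fin (n + 1) → S) × S => F q.1 q.2) := measurable_of_countable _
  have : IsProbabilityMeasure (P.map fun ω => ((fun k : Fin (n + 1) => Y k ω), Y (n + 1) ω)) :=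
    Measure.isProbabilityMeasure_map hZ.aemeasurable
  have hint : Integrable (fun q : (Fin (n + 1) → S) × S => F q.1 q.2)
      (P.map fun ω => ((fun k : Fin (n + 1) => Y k ω), Y (n + 1) ω)) := Integrable.of_finite
  refine ⟨hint.comp_measurable hZ, ?_⟩
  have := integral_map (μ := P) hZ.aemeasurable hF.aestronglyMeasurable
  simp only at this
  rw [← this, integral_fintype hint, Fintype.sum_prod_type]
  refine Finset.sum_congr rfl fun p _ => Finset.sum_congr rfl fun t _ => ?_
  rw [smul_eq_mul, map_measureReal_apply hZ (measurableSet_singleton _)]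
  congr 2
  ext ω
  simp [funext_iff]

/-- The martingale property: `g (Y (n + 1)) - (Q g) (Y n)` is orthogonal to the past. -/
theorem integral_mul_increment (hm : ∀ n s, MeasurableSet {ω | Y n ω = s})
    (law : ∀ (n : ℕ) (s : ℕ → S), P.real {ω | ∀ k ≤ n + 1, Y k ω = s k} =
      P.real {ω | ∀ k ≤ n, Y k ω = s k} * Q (s n) (s (n + 1)))
    (hQ1 : ∀ x, ∑ y, Q x y = 1)
    (g : S → ℝ) (n : ℕ) (F : (Fin (n + 1) → S) → ℝ) :
    ∫ ω, F (fun k => Y k ω) * (g (Y (n + 1) ω) - ∑ t, Q (Y n ω) t * g t) ∂P = 0 := by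
  classical
  have h := (integral_path (P := P) hm n
    (fun p t => F p * (g t - ∑ u, Q (p (Fin.last n)) u * g u))).2
  simp only [Fin.val_last] at h
  rw [h]
  refine Finset.sum_eq_zero fun p _ => ?_
  have hcyl : ∀ t, P.real {ω | (∀ k : Fin (n + 1), Y k ω = p k) ∧ Y (n + 1) ω = t} =
      P.real {ω | ∀ k : Fin (n + 1), Y k ω = p k} * Q (p (Fin.last n)) t := by
    intro t
    have := law n (fun k => if hk : k < n + 1 then p ⟨k, hk⟩ else t)
    simp only [lt_add_iff_pos_right, zero_lt_one, dite_true, lt_self_iff_false, dite_false] at this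
    have e1 : {ω | (∀ k : Fin (n + 1), Y k ω = p k) ∧ Y (n + 1) ω = t} =
        {ω | ∀ k ≤ n + 1, Y k ω = if hk : k < n + 1 then p ⟨k, hk⟩ else t} := by
      ext ω
      constructor
      · rintro ⟨h1, h2⟩ k hk
        by_cases hk' : k < n + 1
        · simpa [hk'] using h1 ⟨k, hk'⟩
        · obtain rfl : k = n + 1 := by omega
          simpa using h2
      · intro h1
        refine ⟨fun k => ?_, ?_⟩
        · simpa [k.2] using h1 k (by omega)
        · simpa using h1 (n + 1) le_rfl
    have e2 : {ω | ∀ k : Fin (n + 1), Y k ω = p k} =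
        {ω | ∀ k ≤ n, Y k ω = if hk : k < n + 1 then p ⟨k, hk⟩ else t} := by
      ext ω
      constructor
      · intro h1 k hk
        have hk' : k < n + 1 := by omega
        simpa [hk'] using h1 ⟨k, hk'⟩
      · intro h1 k
        simpa [k.2] using h1 k (by omega)
    rw [e1, e2]
    exact this
  simp only [hcyl]
  have : ∀ t, P.real {ω | ∀ k : Fin (n + 1), Y k ω = p k} * Q (p (Fin.last n)) t *
      (F p * (g t - ∑ u, Q (p (Fin.last n)) u * g u)) =
      P.real {ω | ∀ k : Fin (n + 1), Y k ω = p k} * F p * (Q (p (Fin.last n)) t * g t -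
        Q (p (Fin.last n)) t * ∑ u, Q (p (Fin.last n)) u * g u) := fun t => by ring
  simp only [this]
  rw [← Finset.mul_sum, Finset.sum_sub_distrib, ← Finset.sum_mul, hQ1, one_mul, sub_self, mul_zero]

/-- Uncorrelated increments: the second moment of the martingale grows linearly. -/
theorem integral_sq_sum_increments_le (hm : ∀ n s, MeasurableSet {ω | Y n ω = s})
    (law : ∀ (n : ℕ) (s : ℕ → S), P.real {ω | ∀ k ≤ n + 1, Y k ω = s k} =
      P.real {ω | ∀ k ≤ n, Y k ω = s k} * Q (s n) (s (n + 1)))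
    (hQ1 : ∀ x, ∑ y, Q x y = 1) (g : S → ℝ) {C : ℝ}
    (hC : ∀ x t, |g t - ∑ u, Q x u * g u| ≤ C) (n : ℕ) :
    Integrable (fun ω =>
      (∑ k ∈ range n, (g (Y (k + 1) ω) - ∑ t, Q (Y k ω) t * g t)) ^ 2) P ∧
    ∫ ω, (∑ k ∈ range n, (g (Y (k + 1) ω) - ∑ t, Q (Y k ω) t * g t)) ^ 2 ∂P ≤ n * C ^ 2 := by
  -- the partial sum as a function of the path
  let F : ∀ n, (Fin (n + 1) → S) → ℝ := fun n p =>
    ∑ k : Fin n, (g (p k.succ) - ∑ t, Q (p k.castSucc) t * g t)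
  have hF : ∀ n ω, ∑ k ∈ range n, (g (Y (k + 1) ω) - ∑ t, Q (Y k ω) t * g t) =
      F n (fun k => Y k ω) := fun n ω => by
    simp only [F, Finset.sum_range, Fin.val_succ, Fin.val_castSucc]
  have hI : ∀ n, Integrable (fun ω =>
      (∑ k ∈ range n, (g (Y (k + 1) ω) - ∑ t, Q (Y k ω) t * g t)) ^ 2) P := fun n => by
    simp only [hF]
    exact (integral_path hm n fun p _ => F n p ^ 2).1
  refine ⟨hI n, ?_⟩
  induction n with
  | zero => simp
  | succ n ih =>
    have hcross : Integrable (fun ω => F n (fun k => Y k ω) *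
        (g (Y (n + 1) ω) - ∑ t, Q (Y n ω) t * g t)) P := by
      have := (integral_path (P := P) hm n
        fun p t => F n p * (g t - ∑ u, Q (p (Fin.last n)) u * g u)).1
      simpa only [Fin.val_last] using this
    have hsq : Integrable (fun ω => (g (Y (n + 1) ω) - ∑ t, Q (Y n ω) t * g t) ^ 2) P := by
      have := (integral_path (P := P) hm n
        fun p t => (g t - ∑ u, Q (p (Fin.last n)) u * g u) ^ 2).1
      simpa only [Fin.val_last] using this
    have hsq_le : ∫ ω, (g (Y (n + 1) ω) - ∑ t, Q (Y n ω) t * g t) ^ 2 ∂P ≤ C ^ 2 := by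
      have hb : ∀ ω, (g (Y (n + 1) ω) - ∑ t, Q (Y n ω) t * g t) ^ 2 ≤ C ^ 2 := fun ω => by
        rw [← sq_abs]
        exact pow_le_pow_left₀ (abs_nonneg _) (hC _ _) 2
      simpa using integral_mono hsq (integrable_const (C ^ 2)) hb
    have hexp : ∀ ω, (∑ k ∈ range (n + 1), (g (Y (k + 1) ω) - ∑ t, Q (Y k ω) t * g t)) ^ 2 =
        (∑ k ∈ range n, (g (Y (k + 1) ω) - ∑ t, Q (Y k ω) t * g t)) ^ 2 +
        2 * (F n (fun k => Y k ω) * (g (Y (n + 1) ω) - ∑ t, Q (Y n ω) t * g t)) +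
        (g (Y (n + 1) ω) - ∑ t, Q (Y n ω) t * g t) ^ 2 := fun ω => by
      rw [Finset.sum_range_succ, ← hF]; ring
    simp only [hexp]
    have hadd : Integrable (fun ω =>
        (∑ k ∈ range n, (g (Y (k + 1) ω) - ∑ t, Q (Y k ω) t * g t)) ^ 2 +
        2 * (F n (fun k => Y k ω) * (g (Y (n + 1) ω) - ∑ t, Q (Y n ω) t * g t))) P :=
      (hI n).add (hcross.const_mul 2)
    rw [integral_add hadd hsq, integral_add (hI n) (hcross.const_mul 2),
      integral_const_mul, integral_mul_increment hm law hQ1 g n (F n)]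
    push_cast
    linarith

/-- Law of large numbers for the martingale: along the squares by the second moment bound and
summability, in between because the increments are bounded. -/
theorem tendsto_sum_increments_div (hm : ∀ n s, MeasurableSet {ω | Y n ω = s})
    (law : ∀ (n : ℕ) (s : ℕ → S), P.real {ω | ∀ k ≤ n + 1, Y k ω = s k} =
      P.real {ω | ∀ k ≤ n, Y k ω = s k} * Q (s n) (s (n + 1)))
    (hQ1 : ∀ x, ∑ y, Q x y = 1) (g : S → ℝ) :
    ∀ᵐ ω ∂P, Tendsto (fun n : ℕ =>
      (∑ k ∈ range n, (g (Y (k + 1) ω) - ∑ t, Q (Y k ω) t * g t)) / n) atTop (𝓝 0) := by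
  obtain ⟨C, hC⟩ : ∃ C, ∀ x t, |g t - ∑ u, Q x u * g u| ≤ C :=
    ⟨∑ x, ∑ t, |g t - ∑ u, Q x u * g u|, fun x t =>
      (Finset.single_le_sum (f := fun t => |g t - ∑ u, Q x u * g u|)
        (fun _ _ => abs_nonneg _) (mem_univ t)).trans
      (Finset.single_le_sum (f := fun x => ∑ t, |g t - ∑ u, Q x u * g u|)
        (fun _ _ => Finset.sum_nonneg fun _ _ => abs_nonneg _) (mem_univ x))⟩
  set M : ℕ → Ω → ℝ := fun n ω =>
    ∑ k ∈ range n, (g (Y (k + 1) ω) - ∑ t, Q (Y k ω) t * g t) with hMdef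
  have hM := fun n => integral_sq_sum_increments_le (P := P) hm law hQ1 g hC n
  have hsum : ∑' m : ℕ, ∫⁻ ω, ENNReal.ofReal ((M ((m + 1) ^ 2) ω / ((m + 1 : ℕ) : ℝ) ^ 2) ^ 2) ∂P
      ≠ ⊤ := by
    have hle : ∀ m : ℕ,
        ∫⁻ ω, ENNReal.ofReal ((M ((m + 1) ^ 2) ω / ((m + 1 : ℕ) : ℝ) ^ 2) ^ 2) ∂P ≤
          ENNReal.ofReal (C ^ 2 * (1 / ((m + 1 : ℕ) : ℝ) ^ 2)) := by
      intro m
      have hpos : (0 : ℝ) < ((m + 1 : ℕ) : ℝ) := by positivity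
      have h1 : ∀ ω, (M ((m + 1) ^ 2) ω / ((m + 1 : ℕ) : ℝ) ^ 2) ^ 2 =
          M ((m + 1) ^ 2) ω ^ 2 * (1 / ((m + 1 : ℕ) : ℝ) ^ 4) := fun ω => by
        field_simp
      simp only [h1]
      rw [← ofReal_integral_eq_lintegral_ofReal ((hM ((m + 1) ^ 2)).1.mul_const _)
        (Eventually.of_forall fun ω => by positivity)]
      refine ENNReal.ofReal_le_ofReal ?_
      rw [integral_mul_const]
      have h2 := (hM ((m + 1) ^ 2)).2
      have h3 : C ^ 2 * (1 / ((m + 1 : ℕ) : ℝ) ^ 2) =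
          (((m + 1) ^ 2 : ℕ) : ℝ) * C ^ 2 * (1 / ((m + 1 : ℕ) : ℝ) ^ 4) := by
        push_cast
        have : ((m : ℝ) + 1) ≠ 0 := by positivity
        field_simp
      rw [h3]
      exact mul_le_mul_of_nonneg_right h2 (by positivity)
    refine ne_top_of_le_ne_top ?_ (ENNReal.tsum_le_tsum hle)
    have hs : Summable fun m : ℕ => C ^ 2 * (1 / ((m + 1 : ℕ) : ℝ) ^ 2) :=
      ((summable_nat_add_iff 1).2 (Real.summable_one_div_nat_pow.2 one_lt_two)).mul_left _
    rw [← ENNReal.ofReal_tsum_of_nonneg (fun m => by positivity) hs]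
    exact ENNReal.ofReal_ne_top
  have hae : ∀ m : ℕ, AEMeasurable (fun ω =>
      ENNReal.ofReal ((M ((m + 1) ^ 2) ω / ((m + 1 : ℕ) : ℝ) ^ 2) ^ 2)) P := fun m => by
    simp only [div_pow]
    exact ((hM ((m + 1) ^ 2)).1.aestronglyMeasurable.aemeasurable.div_const _).ennreal_ofReal
  rw [← lintegral_tsum hae] at hsum
  filter_upwards [ae_lt_top' (AEMeasurable.tsum hae) hsum] with ω hω
  have h1 := ENNReal.tendsto_atTop_zero_of_tsum_ne_top hω.ne
  have h2 : Tendsto (fun m : ℕ => (M ((m + 1) ^ 2) ω / ((m + 1 : ℕ) : ℝ) ^ 2) ^ 2) atTop (𝓝 0) := by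
    have := (ENNReal.continuousAt_toReal (ENNReal.zero_ne_top)).tendsto.comp h1
    simpa only [Function.comp_def, ENNReal.toReal_ofReal (sq_nonneg _), ENNReal.toReal_zero]
      using this
  have h3 : Tendsto (fun m : ℕ => |M (m ^ 2) ω / (m : ℝ) ^ 2|) atTop (𝓝 0) := by
    rw [← tendsto_add_atTop_iff_nat 1]
    have := h2.sqrt
    simpa only [Real.sqrt_sq_eq_abs, Real.sqrt_zero] using this
  have hC0 : 0 ≤ C := (abs_nonneg _).trans (hC (Y 0 ω) (Y 0 ω))
  have hdiff : ∀ a b, a ≤ b → |M b ω| ≤ |M a ω| + C * ((b : ℝ) - a) := by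
    intro a b hab
    induction b, hab using Nat.le_induction with
    | base => simp
    | succ b _ ih =>
      have : M (b + 1) ω = M b ω + (g (Y (b + 1) ω) - ∑ t, Q (Y b ω) t * g t) := by
        simp only [hMdef, Finset.sum_range_succ]
      rw [this]
      refine (abs_add_le _ _).trans ?_
      have := hC (Y b ω) (Y (b + 1) ω)
      push_cast
      linarith
  have hsqrt : Tendsto Nat.sqrt atTop atTop :=
    tendsto_atTop_atTop.2 fun b => ⟨b ^ 2, fun a ha => Nat.le_sqrt'.2 ha⟩
  have h4 : Tendsto (fun m : ℕ => |M (m ^ 2) ω / (m : ℝ) ^ 2| + 2 * C / m) atTop (𝓝 0) := by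
    simpa using h3.add (tendsto_const_div_atTop_nhds_zero_nat (2 * C))
  refine squeeze_zero_norm' ?_ (h4.comp hsqrt)
  filter_upwards [eventually_ge_atTop 1] with n hn
  have hs1 : 0 < Nat.sqrt n := Nat.sqrt_pos.2 hn
  have hs2 : (Nat.sqrt n) ^ 2 ≤ n := Nat.sqrt_le' n
  have hs3 : n ≤ (Nat.sqrt n) ^ 2 + 2 * Nat.sqrt n := by
    have := Nat.sqrt_le_add n; nlinarith
  have h5 := hdiff _ _ hs2
  set r := Nat.sqrt n
  have hr : (0 : ℝ) < r := by exact_mod_cast hs1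
  have hrn : (r : ℝ) ^ 2 ≤ n := by exact_mod_cast hs2
  have hnr : (n : ℝ) ≤ r ^ 2 + 2 * r := by exact_mod_cast hs3
  have hn0 : (0 : ℝ) < n := by positivity
  simp only [Function.comp, Real.norm_eq_abs, abs_div, abs_pow, Nat.abs_cast]
  calc |M n ω| / n ≤ (|M (r ^ 2) ω| + C * (2 * r)) / n := by
        gcongr
        refine h5.trans ?_
        push_cast
        gcongr
        linarith
    _ ≤ (|M (r ^ 2) ω| + C * (2 * r)) / r ^ 2 := by gcongr
    _ = |M (r ^ 2) ω| / r ^ 2 + 2 * C / r := by field_simp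

/-- The ergodic theorem: time averages along a chain that solve a Poisson equation converge. -/
theorem tendsto_sum_div (hm : ∀ n s, MeasurableSet {ω | Y n ω = s})
    (law : ∀ (n : ℕ) (s : ℕ → S), P.real {ω | ∀ k ≤ n + 1, Y k ω = s k} =
      P.real {ω | ∀ k ≤ n, Y k ω = s k} * Q (s n) (s (n + 1)))
    (hQ1 : ∀ x, ∑ y, Q x y = 1) {f g : S → ℝ} {c : ℝ}
    (hf : ∀ x, f x = c + (g x - ∑ y, Q x y * g y)) :
    ∀ᵐ ω ∂P, Tendsto (fun n : ℕ => (∑ k ∈ range n, f (Y k ω)) / n) atTop (𝓝 c) := by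
  filter_upwards [tendsto_sum_increments_div hm law hQ1 g] with ω hω
  have hid : ∀ n : ℕ, ∑ k ∈ range n, f (Y k ω) =
      n * c + ∑ k ∈ range n, (g (Y (k + 1) ω) - ∑ t, Q (Y k ω) t * g t) +
        (g (Y 0 ω) - g (Y n ω)) := by
    intro n
    rw [← Finset.sum_range_sub' (fun k => g (Y k ω)) n, add_assoc, ← Finset.sum_add_distrib,
      ← nsmul_eq_mul, ← Finset.card_range n, ← Finset.sum_const, Finset.card_range,
      ← Finset.sum_add_distrib]
    exact Finset.sum_congr rfl fun k _ => by rw [hf]; ring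
  obtain ⟨B, hB⟩ : ∃ B, ∀ x, |g x| ≤ B := ⟨∑ x, |g x|, fun x =>
    Finset.single_le_sum (f := fun x => |g x|) (fun _ _ => abs_nonneg _) (mem_univ x)⟩
  have hbd : Tendsto (fun n : ℕ => (g (Y 0 ω) - g (Y n ω)) / n) atTop (𝓝 0) := by
    refine squeeze_zero_norm (fun n => ?_) (tendsto_const_div_atTop_nhds_zero_nat (2 * B))
    rw [Real.norm_eq_abs, abs_div, Nat.abs_cast]
    gcongr
    refine (abs_sub _ _).trans ?_
    linarith [hB (Y 0 ω), hB (Y n ω)]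
  have := (hω.add hbd).const_add c
  simp only [add_zero] at this
  refine this.congr' ?_
  filter_upwards [eventually_ge_atTop 1] with n hn
  have hn0 : (n : ℝ) ≠ 0 := by positivity
  rw [hid]
  field_simp
  ring

end LLN

/-! ### Lumping a stationary chain -/

section Lump

variable {J I : Type*} [Fintype J] [DecidableEq I]

/-- The mass that `p` puts on the fibre of `v` over `i`. -/
noncomputable def marginal (p : J → ℝ) (v : J → I) (i : I) : ℝ := ∑ x, if v x = i then p x else 0

/-- The transition matrix between the fibres of `v`, averaged over each fibre with the weights
`p`. -/
noncomputable def lump (K : J → J → ℝ) (p : J → ℝ) (v : J → I) (i j : I) : ℝ :=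
  (∑ x, if v x = i then p x * ∑ y, (if v y = j then K x y else 0) else 0) / marginal p v i

theorem sum_marginal [Fintype I] (p : J → ℝ) (v : J → I) : ∑ i, marginal p v i = ∑ x, p x := by
  simp only [marginal]
  rw [Finset.sum_comm]
  simp

theorem marginal_pos {p : J → ℝ} (hp : ∀ x, 0 < p x) {v : J → I} (hv : Function.Surjective v)
    (i : I) : 0 < marginal p v i := by
  obtain ⟨x, rfl⟩ := hv i
  refine Finset.sum_pos' (fun y _ => ?_) ⟨x, mem_univ _, by simpa using hp x⟩
  split_ifs
  exacts [(hp y).le, le_rfl]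

theorem marginal_mul_lump [Fintype I] {K : J → J → ℝ} {p : J → ℝ} (hp : ∀ x, 0 < p x)
    (hst : ∀ y, ∑ x, p x * K x y = p y) {v : J → I} (hv : Function.Surjective v) (j : I) :
    ∑ i, marginal p v i * lump K p v i j = marginal p v j := by
  have : ∀ i, marginal p v i * lump K p v i j =
      ∑ x, if v x = i then p x * ∑ y, (if v y = j then K x y else 0) else 0 := fun i =>
    mul_div_cancel₀ _ (marginal_pos hp hv i).ne'
  simp only [this]
  rw [Finset.sum_comm]
  simp only [Finset.sum_ite_eq, mem_univ, if_true, Finset.mul_sum]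
  rw [Finset.sum_comm, marginal]
  refine Finset.sum_congr rfl fun y _ => ?_
  split_ifs
  · exact hst y
  · simp

theorem IsUnichain.lump [Fintype I] {K : J → J → ℝ} {s₀ : J} (h : IsUnichain K s₀) {p : J → ℝ}
    (hp : ∀ x, 0 < p x) {v : J → I} (hv : Function.Surjective v) :
    IsUnichain (lump K p v) (v s₀) := by
  have hfib : ∀ x j, 0 ≤ ∑ y, (if v y = j then K x y else 0) := fun x j =>
    Finset.sum_nonneg fun y _ => by split_ifs; exacts [h.nonneg x y, le_rfl]
  have hterm : ∀ i j x, 0 ≤ if v x = i then p x * ∑ y, (if v y = j then K x y else 0) else 0 :=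
    fun i j x => by split_ifs; exacts [mul_nonneg (hp x).le (hfib x j), le_rfl]
  have hpos : ∀ x y, K x y ≠ 0 → 0 < FiniteChain.lump K p v (v x) (v y) := by
    intro x y hxy
    refine div_pos (Finset.sum_pos' (fun z _ => hterm _ _ z) ⟨x, mem_univ _, ?_⟩)
      (marginal_pos hp hv _)
    rw [if_pos rfl]
    refine mul_pos (hp x) (Finset.sum_pos' (fun z _ => ?_) ⟨y, mem_univ _, ?_⟩)
    · split_ifs; exacts [h.nonneg x z, le_rfl]
    · rw [if_pos rfl]
      exact lt_of_le_of_ne (h.nonneg x y) (Ne.symm hxy)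
  refine ⟨fun i j => div_nonneg (Finset.sum_nonneg fun x _ => hterm i j x)
    (marginal_pos hp hv i).le, fun i => ?_, fun i => ?_⟩
  · simp only [FiniteChain.lump]
    rw [← Finset.sum_div, Finset.sum_comm, div_eq_one_iff_eq (marginal_pos hp hv i).ne', marginal]
    refine Finset.sum_congr rfl fun x _ => ?_
    split_ifs
    · rw [← Finset.mul_sum, Finset.sum_comm]
      simp [h.sum_one]
    · simp
  · obtain ⟨x, rfl⟩ := hv i
    exact (h.reach x).lift v fun a b hab => (hpos a b hab).ne'

end Lump

/-- An eigenvalue of the transpose of a stochastic matrix has modulus at most `1`: the `ℓ¹` norm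
does not grow. -/
theorem IsUnichain.norm_eigenvalue_le {I : Type*} [Fintype I] {A : I → I → ℝ} {i₀ : I}
    (h : IsUnichain A i₀) {c : ℂ} {z : I → ℂ} (hz : z ≠ 0)
    (hc : ∀ j, ∑ i, (A i j : ℂ) * z i = c * z j) : ‖c‖ ≤ 1 := by
  have hpos : 0 < ∑ j, ‖z j‖ := by
    obtain ⟨j, hj⟩ := Function.ne_iff.1 hz
    exact Finset.sum_pos' (fun _ _ => norm_nonneg _) ⟨j, mem_univ _, norm_pos_iff.2 hj⟩
  refine le_of_mul_le_mul_right ?_ hpos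
  rw [one_mul]
  calc ‖c‖ * ∑ j, ‖z j‖ = ∑ j, ‖∑ i, (A i j : ℂ) * z i‖ := by
        rw [Finset.mul_sum]
        exact Finset.sum_congr rfl fun j _ => by rw [hc, norm_mul]
    _ ≤ ∑ j, ∑ i, A i j * ‖z i‖ := Finset.sum_le_sum fun j _ => (norm_sum_le _ _).trans_eq
        (Finset.sum_congr rfl fun i _ => by
          rw [norm_mul, Complex.norm_real, Real.norm_of_nonneg (h.nonneg i j)])
    _ = ∑ i, ‖z i‖ := by
        rw [Finset.sum_comm]
        exact Finset.sum_congr rfl fun i _ => by rw [← Finset.sum_mul, h.sum_one, one_mul]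

end FiniteChain

namespace GrammarWalk

open FiniteChain Filter MeasureTheory

/-! ### One step of the walker -/

section Step

variable {R C : Type*} {N : SemanticNetwork R} {Ψ : Grammar R C}

theorem chooseFrom_ne_zero {α β : Type*} {S : Finset α} {f : α → PMF β} {z : PMF β} {b : β}
    (h : chooseFrom S f z b ≠ 0) : (∃ x ∈ S, f x b ≠ 0) ∨ z b ≠ 0 := by
  unfold chooseFrom at h
  split_ifs at h with hS
  · left
    rw [← PMF.mem_support_iff, PMF.mem_support_bind_iff] at h
    obtain ⟨x, hx, hb⟩ := h
    exact ⟨x, (PMF.mem_support_uniformOfFinset_iff hS x).1 hx, (PMF.mem_support_iff _ _).1 hb⟩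
  · exact Or.inr h

theorem pure_ne_zero {β : Type*} {a b : β} (h : PMF.pure a b ≠ 0) : b = a := by
  by_contra hne
  exact h (PMF.pure_apply_of_ne a b hne)

theorem map_context_of_mem_reresolutions [Fintype R] [Fintype C] {oi on : Bool}
    {old : List (Visit R C)} : ∀ {l q : List (Visit R C)}, q ∈ reresolutions N Ψ oi on old l →
      q.map Visit.context = l.map Visit.context
  | [], q, h => by simpa [reresolutions] using h
  | t :: ts, q, h => by
    simp only [reresolutions, Finset.mem_biUnion, Finset.mem_image, Finset.mem_filter] at h
    obtain ⟨qs, hqs, p, ⟨-, hp⟩, rfl⟩ := h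
    simp [map_context_of_mem_reresolutions hqs, hp.1]

theorem IsIncr.exists_vertex {s : State R C} (h : IsIncr Ψ s) : ∃ i, s.vertex = some i := by
  rcases s with _ | ⟨_ | ⟨v, l⟩, k⟩
  · exact absurd h (by simp [IsIncr, State.rule])
  · exact absurd h (by simp [IsIncr, State.rule])
  · exact ⟨v.vertex, rfl⟩

variable [Fintype R] [Fintype C]

/-- What one rule execution can do: a halt, an arrival, or going on to the next rule of the same
context, possibly with another path through the same contexts. -/
theorem step_ne_zero {a b : State R C} (h : step N Ψ a b ≠ 0) :
    b = none ∨ (∃ l, b = some (l, 0) ∧ l.length ≤ Ψ.memory) ∨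
    ∃ l l' k v, a = some (l, k) ∧ b = some (l', k + 1) ∧
      l'.map Visit.context = l.map Visit.context ∧
      l.head? = some v ∧ k < (Ψ.rules v.context).length := by
  match a with
  | none =>
    rcases chooseFrom_ne_zero h with ⟨c, -, hc⟩ | hz
    · rcases chooseFrom_ne_zero hc with ⟨i, -, hi⟩ | hz
      · exact Or.inr (Or.inl ⟨_, pure_ne_zero hi, by simp [Grammar.memory]⟩)
      · exact Or.inl (pure_ne_zero hz)
    · exact Or.inl (pure_ne_zero hz)
  | some ([], k) => exact Or.inl (pure_ne_zero h)
  | some (v :: l, k) =>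
    have next : ∀ {l'}, k < (Ψ.rules v.context).length →
        l'.map Visit.context = (v :: l).map Visit.context →
        b = some (l', k + 1) → ∃ l₁ l' k' v', (some (v :: l, k) : State R C) = some (l₁, k') ∧
          b = some (l', k' + 1) ∧ l'.map Visit.context = l₁.map Visit.context ∧
          l₁.head? = some v' ∧ k' < (Ψ.rules v'.context).length :=
      fun hk hl hb => ⟨_, _, k, v, rfl, hb, hl, rfl, hk⟩
    simp only [step] at h
    cases hr : (Ψ.rules v.context)[k]? with
    | none => simp only [hr] at h; exact Or.inl (pure_ne_zero h)
    | some r =>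
      have hk : k < (Ψ.rules v.context).length := (List.getElem?_eq_some_iff.1 hr).1
      rw [hr] at h
      cases r with
      | incrCount => exact Or.inr (Or.inr (next hk rfl (pure_ne_zero h)))
      | submitCounts => exact Or.inr (Or.inr (next hk rfl (pure_ne_zero h)))
      | traverse E =>
        rcases chooseFrom_ne_zero h with ⟨τ, -, hτ⟩ | hz
        · rcases chooseFrom_ne_zero hτ with ⟨y, -, hy⟩ | hz
          · exact Or.inr (Or.inl ⟨_, pure_ne_zero hy, by simp⟩)
          · exact Or.inr (Or.inr (next hk rfl (pure_ne_zero hz)))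
        · exact Or.inr (Or.inr (next hk rfl (pure_ne_zero hz)))
      | reresolve d hd m oi on =>
        simp only [reresolveLaw] at h
        split_ifs at h with hm
        · rw [← PMF.mem_support_iff, PMF.mem_support_bind_iff] at h
          obtain ⟨b', -, hb⟩ := h
          rw [PMF.mem_support_iff] at hb
          split_ifs at hb
          · rcases chooseFrom_ne_zero hb with ⟨q, hq, hqb⟩ | hz
            · refine Or.inr (Or.inr (next hk ?_ (pure_ne_zero hqb)))
              rw [List.map_append, map_context_of_mem_reresolutions hq, ← List.map_append,
                List.take_append_drop]
            · exact Or.inr (Or.inr (next hk rfl (pure_ne_zero hz)))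
          · exact Or.inr (Or.inr (next hk rfl (pure_ne_zero hb)))
        · exact Or.inr (Or.inr (next hk rfl (pure_ne_zero h)))

/-- The walker has finitely many states: its history is cut off at the memory of the grammar, and its
position in the list of rules is bounded. -/
theorem finite_reach : {s : State R C | Reach N Ψ none s}.Finite := by
  set K := Finset.univ.sup fun c => (Ψ.rules c).length with hK
  have hfin : (insert none (some '' ({l : List (Visit R C) | l.length ≤ Ψ.memory} ×ˢ
      {k : ℕ | k ≤ K})) : Set (State R C)).Finite :=
    (((List.finite_length_le _ _).prod (Set.finite_le_nat K)).image _).insert _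
  refine hfin.subset fun s hs => ?_
  change Relation.ReflTransGen _ _ _ at hs
  induction hs with
  | refl => exact Set.mem_insert _ _
  | @tail b c _ hbc ih =>
    rcases step_ne_zero hbc with rfl | ⟨l, rfl, hl⟩ | ⟨l, l', k, v, rfl, rfl, hl, -, hk⟩
    · exact Set.mem_insert _ _
    · exact Or.inr ⟨(l, 0), ⟨hl, Nat.zero_le _⟩, rfl⟩
    · refine Or.inr ⟨(l', k + 1), ⟨?_, ?_⟩, rfl⟩
      · rcases ih with h | ⟨p, ⟨hp, -⟩, hpl⟩
        · exact absurd h (Option.some_ne_none _)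
        · obtain rfl : p = (l, k) := Option.some_injective _ hpl
          have := congrArg List.length hl
          simp only [List.length_map] at this
          exact this.trans_le hp
      · exact (Nat.succ_le_of_lt hk).trans
          (Finset.le_sup (f := fun c => (Ψ.rules c).length) (Finset.mem_univ _))

theorem Recurrent.of_reach {s t : State R C} (hs : Recurrent N Ψ s) (h : Reach N Ψ s t) :
    Recurrent N Ψ t :=
  ⟨Relation.ReflTransGen.trans hs.1 h, fun u hu =>
    Relation.ReflTransGen.trans (hs.2 u (Relation.ReflTransGen.trans h hu)) h⟩

/-- A state from which as few states as possible can be reached is recurrent. -/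
theorem exists_recurrent_of_reach {s : State R C} (hs : Reach N Ψ none s) :
    ∃ t, Reach N Ψ s t ∧ Recurrent N Ψ t := by
  induction hn : {u | Reach N Ψ s u}.ncard using Nat.strong_induction_on generalizing s with
  | _ n ih =>
    by_cases h : ∀ t, Reach N Ψ s t → Reach N Ψ t s
    · exact ⟨s, Relation.ReflTransGen.refl, hs, h⟩
    · push Not at h
      obtain ⟨t, hst, hts⟩ := h
      have hsub : {u | Reach N Ψ t u} ⊂ {u | Reach N Ψ s u} :=
        ⟨fun u hu => Relation.ReflTransGen.trans hst hu,
          fun hle => hts (hle (Relation.ReflTransGen.refl : Reach N Ψ s s))⟩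
      have hfin : {u | Reach N Ψ s u}.Finite :=
        (finite_reach (N := N) (Ψ := Ψ)).subset fun u hu => Relation.ReflTransGen.trans hs hu
      obtain ⟨u, htu, hu⟩ := ih _ (hn ▸ Set.ncard_lt_ncard hsub hfin)
        (Relation.ReflTransGen.trans hs hst) rfl
      exact ⟨u, Relation.ReflTransGen.trans hst htu, hu⟩

end Step

/-! ### The contracted network -/

section Contracted

open scoped Classical in
/-- First-step decomposition of the contracted weights. -/
theorem contracted_eq {R C : Type*} [Fintype R] [Fintype C] (N : SemanticNetwork R)
    (Ψ : Grammar R C) (x y : State R C) :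
    contracted N Ψ x y = (if IsIncr Ψ y then step N Ψ x y else 0) +
      ∑' z, if IsIncr Ψ z then 0 else step N Ψ x z * contracted N Ψ z y := by
  rw [contracted, tsum_eq_zero_add' ENNReal.summable]
  congr 1
  simp only [firstIncr]
  rw [ENNReal.tsum_comm]
  refine tsum_congr fun z => ?_
  split_ifs
  · simp
  · rw [ENNReal.tsum_mul_left, contracted]

variable {R C : Type*} [Fintype R] [Fintype C] {N : SemanticNetwork R} {Ψ : Grammar R C}

theorem firstIncr_ne_zero {n : ℕ} {x y : State R C} (h : firstIncr N Ψ n x y ≠ 0) :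
    Reach N Ψ x y ∧ IsIncr Ψ y := by
  induction n generalizing x with
  | zero =>
    simp only [firstIncr, ne_eq, ite_eq_right_iff, Classical.not_imp] at h
    exact ⟨Relation.ReflTransGen.single h.2, h.1⟩
  | succ n ih =>
    simp only [firstIncr, ne_eq, ENNReal.tsum_eq_zero, not_forall] at h
    obtain ⟨z, hz⟩ := h
    split_ifs at hz
    · exact absurd rfl hz
    · obtain ⟨h1, h2⟩ := ih (right_ne_zero_of_mul hz)
      exact ⟨Relation.ReflTransGen.head (left_ne_zero_of_mul hz) h1, h2⟩

theorem contracted_ne_zero {x y : State R C} (h : contracted N Ψ x y ≠ 0) :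
    Reach N Ψ x y ∧ IsIncr Ψ y := by
  simp only [contracted, ne_eq, ENNReal.tsum_eq_zero, not_forall] at h
  obtain ⟨n, hn⟩ := h
  exact firstIncr_ne_zero hn

theorem contracted_ne_zero_of_step {x y : State R C} (h : step N Ψ x y ≠ 0) (hy : IsIncr Ψ y) :
    contracted N Ψ x y ≠ 0 := by
  rw [contracted_eq, if_pos hy]
  exact fun h0 => h (add_eq_zero.1 h0).1

theorem contracted_ne_zero_of_step_of_not_isIncr {x z y : State R C} (h : step N Ψ x z ≠ 0)
    (hz : ¬ IsIncr Ψ z) (hy : contracted N Ψ z y ≠ 0) : contracted N Ψ x y ≠ 0 := by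
  rw [contracted_eq]
  intro h0
  have := ENNReal.tsum_eq_zero.1 (add_eq_zero.1 h0).2 z
  rw [if_neg hz] at this
  exact mul_ne_zero h hy this

/-- A path to an indexing state is cut at the indexing states on it. -/
theorem contractedReach_of_reach {x y : State R C} (h : Reach N Ψ x y) (hy : IsIncr Ψ y) :
    Relation.ReflTransGen (fun a b => contracted N Ψ a b ≠ 0) x y := by
  have key : (IsIncr Ψ x ∧ Relation.ReflTransGen (fun a b => contracted N Ψ a b ≠ 0) x y) ∨
      ∃ w, contracted N Ψ x w ≠ 0 ∧
        Relation.ReflTransGen (fun a b => contracted N Ψ a b ≠ 0) w y := by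
    change Relation.ReflTransGen _ _ _ at h
    induction h using Relation.ReflTransGen.head_induction_on with
    | refl => exact Or.inl ⟨hy, Relation.ReflTransGen.refl⟩
    | @head a b hab _ ih =>
      right
      by_cases hb : IsIncr Ψ b
      · refine ⟨b, contracted_ne_zero_of_step hab hb, ?_⟩
        rcases ih with ⟨-, h⟩ | ⟨w, hw, h⟩
        exacts [h, h.head hw]
      · rcases ih with ⟨h, -⟩ | ⟨w, hw, h⟩
        exacts [absurd h hb, ⟨w, contracted_ne_zero_of_step_of_not_isIncr hab hb hw, h⟩]
  rcases key with ⟨-, h⟩ | ⟨w, hw, h⟩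
  exacts [h, h.head hw]

open scoped Classical in
theorem tsum_contracted_eq (x : State R C) : ∑' y, contracted N Ψ x y =
    ∑' z, step N Ψ x z * if IsIncr Ψ z then 1 else ∑' y, contracted N Ψ z y := by
  simp only [contracted_eq N Ψ x]
  rw [ENNReal.tsum_add, ENNReal.tsum_comm, ← ENNReal.tsum_add]
  refine tsum_congr fun z => ?_
  split_ifs
  · simp
  · rw [ENNReal.tsum_mul_left, zero_add]

/-- The weights out of a state sum to at most `1`, by induction on the number of steps after which
paths are cut off. -/
theorem tsum_contracted_le_one (x : State R C) : ∑' y, contracted N Ψ x y ≤ 1 := by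
  classical
  have key : ∀ n x, ∑ k ∈ Finset.range n, ∑' y, firstIncr N Ψ k x y ≤ 1 := by
    intro n
    induction n with
    | zero => simp
    | succ n ih =>
      intro x
      have h0 : ∑' y, firstIncr N Ψ 0 x y = ∑' z, if IsIncr Ψ z then step N Ψ x z else 0 := rfl
      have h1 : ∀ k, ∑' y, firstIncr N Ψ (k + 1) x y =
          ∑' z, if IsIncr Ψ z then 0 else step N Ψ x z * ∑' y, firstIncr N Ψ k z y := by
        intro k
        simp only [firstIncr]
        rw [ENNReal.tsum_comm]
        refine tsum_congr fun z => ?_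
        split_ifs
        · simp
        · rw [ENNReal.tsum_mul_left]
      rw [Finset.sum_range_succ', h0]
      simp only [h1]
      rw [← Summable.tsum_finsetSum fun _ _ => ENNReal.summable, ← ENNReal.tsum_add,
        ← PMF.tsum_coe (step N Ψ x)]
      refine ENNReal.tsum_le_tsum fun z => ?_
      split_ifs
      · simp
      · rw [← Finset.mul_sum, add_zero]
        exact mul_le_of_le_one_right' (ih z)
  have hswap : ∑' y, contracted N Ψ x y = ∑' n, ∑' y, firstIncr N Ψ n x y := by
    simp only [contracted]
    rw [ENNReal.tsum_comm]
  rw [hswap, ENNReal.tsum_eq_iSup_nat]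
  exact iSup_le fun n => key n x

theorem contracted_le_one (x y : State R C) : contracted N Ψ x y ≤ 1 :=
  (ENNReal.le_tsum y).trans (tsum_contracted_le_one x)

open scoped Classical in
/-- A stationary law of the walker, restricted to the indexing states, is stationary for the
contracted weights: in the first-step decomposition the mass passing through the other states
cancels. -/
theorem tsum_stationary_mul_contracted {μ : State R C → ℝ≥0∞} (hfin : ∑' x, μ x ≠ ⊤)
    (hμ : ∀ y, ∑' x, μ x * step N Ψ x y = μ y) {y : State R C} (hy : IsIncr Ψ y) :
    ∑' x, (if IsIncr Ψ x then μ x else 0) * contracted N Ψ x y = μ y := by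
  have h1 : ∑' x, μ x * contracted N Ψ x y =
      μ y + ∑' z, (if IsIncr Ψ z then 0 else μ z) * contracted N Ψ z y := by
    calc ∑' x, μ x * contracted N Ψ x y
        = ∑' x, (μ x * step N Ψ x y + ∑' z, μ x * step N Ψ x z *
            (if IsIncr Ψ z then 0 else contracted N Ψ z y)) := by
          refine tsum_congr fun x => ?_
          rw [contracted_eq, if_pos hy, mul_add, ← ENNReal.tsum_mul_left]
          congr 1
          refine tsum_congr fun z => ?_
          split_ifs
          · simp
          · rw [mul_assoc]
      _ = _ := by
          rw [ENNReal.tsum_add, hμ, ENNReal.tsum_comm]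
          congr 1
          refine tsum_congr fun z => ?_
          rw [ENNReal.tsum_mul_right, hμ]
          split_ifs <;> simp
  have h2 : ∑' x, μ x * contracted N Ψ x y =
      ∑' x, (if IsIncr Ψ x then μ x else 0) * contracted N Ψ x y +
        ∑' z, (if IsIncr Ψ z then 0 else μ z) * contracted N Ψ z y := by
    rw [← ENNReal.tsum_add]
    refine tsum_congr fun x => ?_
    split_ifs <;> simp
  have h3 : ∑' z, (if IsIncr Ψ z then 0 else μ z) * contracted N Ψ z y ≠ ⊤ := by
    refine ne_top_of_le_ne_top hfin (ENNReal.tsum_le_tsum fun z => ?_)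
    split_ifs
    · simp
    · exact mul_le_of_le_one_right' (contracted_le_one z y)
  exact (ENNReal.add_left_inj h3).1 (h2.symm.trans h1)

end Contracted

/-! ### The finite chain of reachable states and its stationary law -/

section Chain

variable {R C : Type*} [Fintype R] [Fintype C] (N : SemanticNetwork R) (Ψ : Grammar R C)

/-- The states that a walker can get to; they are finitely many. -/
abbrev ReachState : Type _ := {s : State R C // Reach N Ψ none s}

noncomputable instance : Fintype (ReachState N Ψ) :=
  have : Finite (ReachState N Ψ) := (finite_reach (N := N) (Ψ := Ψ)).to_subtype
  Fintype.ofFinite _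

/-- The recurrent states at which a vertex is indexed. -/
abbrev IndexingState : Type _ := {s : State R C // Recurrent N Ψ s ∧ IsIncr Ψ s}

noncomputable instance : Fintype (IndexingState N Ψ) :=
  have : Finite (IndexingState N Ψ) :=
    ((finite_reach (N := N) (Ψ := Ψ)).subset fun _ hs => hs.1.1).to_subtype
  Fintype.ofFinite _

/-- The transition matrix of the walker on the reachable states. -/
noncomputable def reachStep (s t : ReachState N Ψ) : ℝ := (step N Ψ s t).toReal

/-- The contracted weights between the recurrent indexing states. -/
noncomputable def contractedStep (s t : IndexingState N Ψ) : ℝ := (contracted N Ψ s t).toReal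

variable {N Ψ}

theorem tsum_eq_sum_subtype {α : Type*} {p : α → Prop} [Fintype {a // p a}] {f : α → ℝ≥0∞}
    (hf : ∀ a, f a ≠ 0 → p a) : ∑' a, f a = ∑ a : {a // p a}, f a := by
  rw [← tsum_fintype (L := .unconditional _)]
  exact (tsum_subtype_eq_of_support_subset (s := {a | p a}) fun a ha => hf a ha).symm

theorem step_ne_top (x y : State R C) : step N Ψ x y ≠ ⊤ := PMF.apply_ne_top _ _

theorem contracted_ne_top (x y : State R C) : contracted N Ψ x y ≠ ⊤ :=
  ne_top_of_le_ne_top ENNReal.one_ne_top (contracted_le_one x y)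

theorem reachStep_ne_zero_iff {s t : ReachState N Ψ} :
    reachStep N Ψ s t ≠ 0 ↔ step N Ψ s t ≠ 0 := by
  simp [reachStep, ENNReal.toReal_eq_zero_iff, step_ne_top]

theorem reflTransGen_reachStep {s t : ReachState N Ψ} :
    Relation.ReflTransGen (fun a b => reachStep N Ψ a b ≠ 0) s t ↔ Reach N Ψ s t := by
  constructor
  · intro h
    exact h.lift (fun s : ReachState N Ψ => (s : State R C)) fun a b => reachStep_ne_zero_iff.1
  · intro h
    obtain ⟨t, ht⟩ := t
    obtain ⟨s, hs⟩ := s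
    change Relation.ReflTransGen _ _ _ at h
    simp only at h
    induction h with
    | refl => exact Relation.ReflTransGen.refl
    | @tail b c hsb hbc ih =>
      have hb : Reach N Ψ none b := Relation.ReflTransGen.trans hs hsb
      exact (ih hb).tail (reachStep_ne_zero_iff.2 hbc)

theorem sum_reachStep_mul (s : ReachState N Ψ) {f : State R C → ℝ≥0∞} (hf : ∀ t, f t ≠ ⊤) :
    (∑' t, step N Ψ s t * f t).toReal = ∑ t, reachStep N Ψ s t * (f t).toReal := by
  rw [tsum_eq_sum_subtype (p := fun s => Reach N Ψ none s) fun t ht =>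
    Relation.ReflTransGen.tail s.2 (left_ne_zero_of_mul ht),
    ENNReal.toReal_sum fun t _ => ENNReal.mul_ne_top (step_ne_top _ _) (hf _)]
  simp only [ENNReal.toReal_mul, reachStep]

theorem isUnichain_reachStep (hconn : StronglyConnected N Ψ) {s₀ : State R C}
    (hs₀ : Recurrent N Ψ s₀) : IsUnichain (reachStep N Ψ) ⟨s₀, hs₀.1⟩ where
  nonneg _ _ := ENNReal.toReal_nonneg
  sum_one s := by
    have := sum_reachStep_mul s (f := fun _ => 1) fun _ => ENNReal.one_ne_top
    simpa only [mul_one, ENNReal.toReal_one, PMF.tsum_coe] using this.symm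
  reach s := by
    obtain ⟨t, hst, ht⟩ := exists_recurrent_of_reach s.2
    exact reflTransGen_reachStep.2 (Relation.ReflTransGen.trans hst (hconn t s₀ ht hs₀))

/-- From every reachable state the walker almost surely comes to an indexing state: the probability
that it does not, set to `0` at the indexing states, is subharmonic. -/
theorem tsum_contracted_eq_one (hconn : StronglyConnected N Ψ) {s₀ : State R C}
    (hs₀ : Recurrent N Ψ s₀) (hi₀ : IsIncr Ψ s₀) {x : State R C} (hx : Reach N Ψ none x) :
    ∑' y, contracted N Ψ x y = 1 := by
  classical
  have hU := isUnichain_reachStep hconn hs₀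
  have hle : ∀ z, ∑' y, contracted N Ψ z y ≤ 1 := tsum_contracted_le_one
  have hfin : ∀ z, ∑' y, contracted N Ψ z y ≠ ⊤ := fun z =>
    ne_top_of_le_ne_top ENNReal.one_ne_top (hle z)
  let w : ReachState N Ψ → ℝ := fun z =>
    if IsIncr Ψ z.1 then 0 else 1 - (∑' y, contracted N Ψ z y).toReal
  have hstep : ∀ z : ReachState N Ψ, 1 - (∑' y, contracted N Ψ z y).toReal =
      ∑ t, reachStep N Ψ z t * w t := by
    intro z
    rw [tsum_contracted_eq, sum_reachStep_mul z fun t => by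
      split_ifs; exacts [ENNReal.one_ne_top, hfin t], ← hU.sum_one z, ← Finset.sum_sub_distrib]
    refine Finset.sum_congr rfl fun t _ => ?_
    simp only [w]
    split_ifs <;> simp [mul_sub]
  have hw0 : ∀ z, 0 ≤ w z := fun z => by
    simp only [w]
    split_ifs
    · exact le_rfl
    · have := ENNReal.toReal_mono ENNReal.one_ne_top (hle z)
      rw [ENNReal.toReal_one] at this
      linarith
  have hw : ∀ z, w z = 0 := fun z => by
    refine le_antisymm ?_ (hw0 z)
    have := hU.subharmonic_le (g := w) (fun z => ?_) z
    · simpa [w, hi₀] using this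
    · rw [← hstep]
      by_cases hz : IsIncr Ψ z.1
      · have := hstep z
        have h2 : 0 ≤ ∑ t, reachStep N Ψ z t * w t :=
          Finset.sum_nonneg fun t _ => mul_nonneg (hU.nonneg z t) (hw0 t)
        simp only [w, hz, if_true]
        rwa [← hstep] at h2
      · simp [w, hz]
  have h1 := hstep ⟨x, hx⟩
  simp only [hw, mul_zero, Finset.sum_const_zero] at h1
  rw [← ENNReal.ofReal_toReal (hfin x), (sub_eq_zero.1 h1).symm, ENNReal.ofReal_one]

theorem isUnichain_contractedStep (hconn : StronglyConnected N Ψ) (s₀ : IndexingState N Ψ) :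
    IsUnichain (contractedStep N Ψ) s₀ where
  nonneg _ _ := ENNReal.toReal_nonneg
  sum_one s := by
    have h := tsum_contracted_eq_one hconn s₀.2.1 s₀.2.2 s.2.1.1
    rw [tsum_eq_sum_subtype (p := fun s => Recurrent N Ψ s ∧ IsIncr Ψ s) fun t ht =>
      ⟨s.2.1.of_reach (contracted_ne_zero ht).1, (contracted_ne_zero ht).2⟩] at h
    simp only [contractedStep]
    rw [← ENNReal.toReal_sum fun t _ => contracted_ne_top _ _, h, ENNReal.toReal_one]
  reach s := by
    obtain ⟨s, hs⟩ := s
    have h := contractedReach_of_reach (hconn s s₀ hs.1 s₀.2.1) s₀.2.2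
    induction h using Relation.ReflTransGen.head_induction_on with
    | refl => exact Relation.ReflTransGen.refl
    | @head a b hab _ ih =>
      have hb : Recurrent N Ψ b ∧ IsIncr Ψ b :=
        ⟨hs.1.of_reach (contracted_ne_zero hab).1, (contracted_ne_zero hab).2⟩
      refine Relation.ReflTransGen.head ?_ (ih hb)
      simpa [contractedStep, ENNReal.toReal_eq_zero_iff, contracted_ne_top] using hab

/-- The real form of stationarity for the contracted network. -/
theorem IsContractedStationary.sum_mul_contractedStep {ν : PMF (State R C)}
    (hν : IsContractedStationary N Ψ ν) (y : IndexingState N Ψ) :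
    ∑ x : IndexingState N Ψ, (ν x).toReal * contractedStep N Ψ x y = (ν y).toReal := by
  rw [← hν.2 y, tsum_eq_sum_subtype (p := fun s => Recurrent N Ψ s ∧ IsIncr Ψ s) fun t ht =>
    hν.1 t (left_ne_zero_of_mul ht),
    ENNReal.toReal_sum fun t _ => ENNReal.mul_ne_top (PMF.apply_ne_top _ _) (contracted_ne_top _ _)]
  simp only [ENNReal.toReal_mul, contractedStep]

theorem IsContractedStationary.sum_eq_one {ν : PMF (State R C)}
    (hν : IsContractedStationary N Ψ ν) : ∑ x : IndexingState N Ψ, (ν x).toReal = 1 := by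
  rw [← ENNReal.toReal_sum fun t _ => PMF.apply_ne_top _ _,
    ← tsum_eq_sum_subtype (p := fun s => Recurrent N Ψ s ∧ IsIncr Ψ s) fun t ht => hν.1 t ht,
    PMF.tsum_coe, ENNReal.toReal_one]

theorem IsContractedStationary.unique (hconn : StronglyConnected N Ψ) (s₀ : IndexingState N Ψ)
    {ν ν' : PMF (State R C)} (hν : IsContractedStationary N Ψ ν)
    (hν' : IsContractedStationary N Ψ ν') : ν' = ν := by
  have h := (isUnichain_contractedStep hconn s₀).stationary_unique hν'.sum_mul_contractedStep
    hν.sum_mul_contractedStep (by rw [hν.sum_eq_one, hν'.sum_eq_one])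
  ext s
  by_cases hs : Recurrent N Ψ s ∧ IsIncr Ψ s
  · have := congrFun h ⟨s, hs⟩
    exact (ENNReal.toReal_eq_toReal_iff' (PMF.apply_ne_top _ _) (PMF.apply_ne_top _ _)).1 this
  · rw [not_imp_comm.1 (hν.1 s) hs, not_imp_comm.1 (hν'.1 s) hs]

/-- The stationary law of the contracted network is the stationary law of the walker, conditioned on
indexing; `Z` is the stationary probability of indexing. So the time averages of functions supported
on the indexing states, being the constants in their Poisson equations, are expectations
under `ν` times `Z`. The frequency of each recurrent state is positive. -/
theorem exists_isContractedStationary (hconn : StronglyConnected N Ψ) (s₀ : IndexingState N Ψ) :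
    ∃ (ν : PMF (State R C)) (Z : ℝ), 0 < Z ∧ IsContractedStationary N Ψ ν ∧
      (∀ s : IndexingState N Ψ, 0 < (ν s).toReal) ∧
      (∀ f : State R C → ℝ, (∀ s, f s ≠ 0 → IsIncr Ψ s) → ∃ g : ReachState N Ψ → ℝ,
        ∀ x : ReachState N Ψ, f x = Z * ∑ s : IndexingState N Ψ, (ν s).toReal * f s +
          (g x - ∑ y, reachStep N Ψ x y * g y)) ∧
      (∀ s, Recurrent N Ψ s → ∃ (c : ℝ) (g : ReachState N Ψ → ℝ), 0 < c ∧ ∀ x : ReachState N Ψ,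
        (Set.indicator {s} 1 (x : State R C) : ℝ) =
          c + (g x - ∑ y, reachStep N Ψ x y * g y)) := by
  classical
  have hU := isUnichain_reachStep hconn s₀.2.1
  obtain ⟨μ, hμ0, hμ1, hμ, hpos₀, hP⟩ := hU.exists_stationary
  have hpos : ∀ s : ReachState N Ψ, Recurrent N Ψ s → 0 < μ s := fun s hs =>
    IsUnichain.stationary_pos_of_reach hU.nonneg hμ0 hμ hpos₀
      (reflTransGen_reachStep.2 (hconn _ _ s₀.2.1 hs))
  have hrec : ∀ s : ReachState N Ψ, μ s ≠ 0 → Recurrent N Ψ s := fun s hs => by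
    by_contra hn
    exact hs (hU.stationary_eq_zero hμ0 hμ fun h =>
      hn (s₀.2.1.of_reach (reflTransGen_reachStep.1 h)))
  -- the stationary law, as a function on all states
  let m : State R C → ℝ≥0∞ := fun s =>
    if h : Reach N Ψ none s then ENNReal.ofReal (μ ⟨s, h⟩) else 0
  have hm_reach : ∀ s, m s ≠ 0 → Reach N Ψ none s := fun s hs => by
    by_contra h; exact hs (dif_neg h)
  have hm_val : ∀ s : ReachState N Ψ, m s = ENNReal.ofReal (μ s) := fun s => dif_pos s.2
  have hm_rec : ∀ s, m s ≠ 0 → Recurrent N Ψ s := fun s hs => by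
    have hr := hm_reach s hs
    refine hrec ⟨s, hr⟩ fun h0 => hs ?_
    rw [hm_val ⟨s, hr⟩, h0, ENNReal.ofReal_zero]
  have hm_sum : ∑' s, m s = 1 := by
    rw [tsum_eq_sum_subtype hm_reach]
    simp only [hm_val]
    rw [← ENNReal.ofReal_sum_of_nonneg fun s _ => hμ0 s, hμ1, ENNReal.ofReal_one]
  have hm_stat : ∀ y, ∑' x, m x * step N Ψ x y = m y := by
    intro y
    by_cases hy : Reach N Ψ none y
    · rw [tsum_eq_sum_subtype (p := fun s => Reach N Ψ none s) fun x hx =>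
        hm_reach x (left_ne_zero_of_mul hx), hm_val ⟨y, hy⟩, ← hμ ⟨y, hy⟩,
        ENNReal.ofReal_sum_of_nonneg fun x _ => mul_nonneg (hμ0 x) (hU.nonneg x _)]
      refine Finset.sum_congr rfl fun x _ => ?_
      rw [hm_val, ENNReal.ofReal_mul (hμ0 x), reachStep, ENNReal.ofReal_toReal (step_ne_top _ _)]
    · have h0 : m y = 0 := dif_neg hy
      rw [h0, ENNReal.tsum_eq_zero]
      intro x
      by_contra hx
      exact hy (Relation.ReflTransGen.tail (hm_reach x (left_ne_zero_of_mul hx))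
        (right_ne_zero_of_mul hx))
  have hm_fin : ∀ s, m s ≠ ⊤ := fun s =>
    ne_top_of_le_ne_top (hm_sum ▸ ENNReal.one_ne_top) (ENNReal.le_tsum s)
  have hm_pos : ∀ s : IndexingState N Ψ, 0 < (m s).toReal := fun s => by
    rw [hm_val ⟨s, s.2.1.1⟩, ENNReal.toReal_ofReal (hμ0 _)]
    exact hpos ⟨s, s.2.1.1⟩ s.2.1
  -- conditioning on the indexing states
  let mi : State R C → ℝ≥0∞ := fun s => if IsIncr Ψ s then m s else 0
  have hmi_le : ∀ s, mi s ≤ m s := fun s => by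
    simp only [mi]; split_ifs; exacts [le_rfl, zero_le]
  have hmi_val : ∀ s : IndexingState N Ψ, mi s = m s := fun s => if_pos s.2.2
  have hmi_supp : ∀ s, mi s ≠ 0 → Recurrent N Ψ s ∧ IsIncr Ψ s := fun s hs => by
    by_cases hi : IsIncr Ψ s
    · exact ⟨hm_rec s (by simpa [mi, hi] using hs), hi⟩
    · exact absurd (if_neg hi) hs
  have hmi_fin : ∑' s, mi s ≠ ⊤ :=
    ne_top_of_le_ne_top (hm_sum ▸ ENNReal.one_ne_top) (ENNReal.tsum_le_tsum hmi_le)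
  have hmi_ne : ∑' s, mi s ≠ 0 := fun h0 => by
    have := ENNReal.tsum_eq_zero.1 h0 s₀
    rw [hmi_val] at this
    exact (hm_pos s₀).ne' (by rw [this, ENNReal.toReal_zero])
  let ν := PMF.normalize mi hmi_ne hmi_fin
  have hν : ∀ s, ν s = mi s * (∑' s, mi s)⁻¹ := PMF.normalize_apply hmi_ne hmi_fin
  have hZ : 0 < (∑' s, mi s).toReal := ENNReal.toReal_pos hmi_ne hmi_fin
  have hνr : ∀ s, (∑' s, mi s).toReal * (ν s).toReal = (mi s).toReal := fun s => by
    rw [hν, ENNReal.toReal_mul, ENNReal.toReal_inv]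
    field_simp
  refine ⟨ν, (∑' s, mi s).toReal, hZ, ⟨fun s hs => hmi_supp s ?_, fun y => ?_⟩, fun s => ?_,
    fun f hf => ?_, fun s hs => ?_⟩
  · rw [hν] at hs
    exact left_ne_zero_of_mul hs
  · by_cases hy : IsIncr Ψ y
    · have := tsum_stationary_mul_contracted (N := N) (hm_sum ▸ ENNReal.one_ne_top) hm_stat hy
      simp only [hν]
      simp only [mul_right_comm _ (∑' s, mi s)⁻¹]
      rw [ENNReal.tsum_mul_right, this]
      simp only [mi, hy, if_true]
    · have h0 : ν y = 0 := by rw [hν]; simp [mi, hy]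
      rw [h0, ENNReal.tsum_eq_zero]
      intro x
      by_contra hx
      exact hy (contracted_ne_zero (right_ne_zero_of_mul hx)).2
  · refine pos_of_mul_pos_right ?_ hZ.le
    rw [hνr, hmi_val]
    exact hm_pos s
  · obtain ⟨g, hg⟩ := hP fun s => f s
    refine ⟨g, fun x => ?_⟩
    rw [hg x]
    congr 1
    rw [Finset.mul_sum]
    have e1 : ∀ s : IndexingState N Ψ, (∑' s, mi s).toReal * ((ν s).toReal * f s) =
        (m s).toReal * f s := fun s => by rw [← mul_assoc, hνr, hmi_val]
    simp only [e1]
    let ι : IndexingState N Ψ → ReachState N Ψ := fun s => ⟨s, s.2.1.1⟩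
    have hι : Function.Injective ι := fun a b hab => Subtype.ext (congrArg (fun s => s.1) hab)
    have e2 : ∀ s : IndexingState N Ψ, (m s).toReal * f s = μ (ι s) * f (ι s) := fun s => by
      rw [hm_val (ι s), ENNReal.toReal_ofReal (hμ0 _)]
    simp only [e2]
    refine (Finset.sum_of_injOn ι hι.injOn (fun _ _ => Finset.mem_coe.2 (Finset.mem_univ _))
      (fun s _ hs => ?_) fun s _ => rfl).symm
    by_contra h0
    exact hs ⟨⟨s, hrec s (left_ne_zero_of_mul h0), hf s (right_ne_zero_of_mul h0)⟩,
      Finset.mem_coe.2 (Finset.mem_univ _), rfl⟩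
  · obtain ⟨g, hg⟩ := hP fun x => Set.indicator {s} 1 (x : State R C)
    refine ⟨_, g, ?_, hg⟩
    refine Finset.sum_pos' (fun x _ => mul_nonneg (hμ0 x) (Set.indicator_nonneg (by simp) _))
      ⟨⟨s, hs.1⟩, Finset.mem_univ _, ?_⟩
    simpa using hpos ⟨s, hs.1⟩ hs

end Chain

/-! ### The implied network as a lumped chain -/

section Implied

/-- The vertex indexed in an indexing state. -/
noncomputable def indexedVertex {R C : Type*} [Fintype R] [Fintype C] (N : SemanticNetwork R)
    (Ψ : Grammar R C) (s : IndexingState N Ψ) : IndexedVertex N Ψ :=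
  ⟨s.2.2.exists_vertex.choose, s, s.2.1, s.2.2, s.2.2.exists_vertex.choose_spec⟩

variable {R C : Type*} [Fintype R] [Fintype C] {N : SemanticNetwork R} {Ψ : Grammar R C}

theorem indexedVertex_eq_iff {s : IndexingState N Ψ} {i : IndexedVertex N Ψ} :
    indexedVertex N Ψ s = i ↔ (s : State R C).vertex = some i.1 := by
  have h : (s : State R C).vertex = some (indexedVertex N Ψ s).1 :=
    s.2.2.exists_vertex.choose_spec
  rw [h]
  exact ⟨fun e => by rw [e], fun e => Subtype.ext (Option.some_injective _ e)⟩

theorem indexedVertex_surjective : Function.Surjective (indexedVertex N Ψ) := fun i => by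
  obtain ⟨s, hs, hi, hv⟩ := i.2
  exact ⟨⟨s, hs, hi⟩, indexedVertex_eq_iff.2 hv⟩

open scoped Classical in
theorem tsum_vertex_toReal {ν : PMF (State R C)}
    (hν : IsContractedStationary N Ψ ν) (i : IndexedVertex N Ψ) :
    (∑' x : State R C, if x.vertex = some i.1 then ν x else 0).toReal =
      marginal (fun s : IndexingState N Ψ => (ν s).toReal) (indexedVertex N Ψ) i := by
  rw [tsum_eq_sum_subtype (p := fun s => Recurrent N Ψ s ∧ IsIncr Ψ s) fun t ht =>
    hν.1 t (ne_of_apply_ne (fun a => if t.vertex = some i.1 then a else 0) (by simpa using ht)),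
    ENNReal.toReal_sum fun t _ => by split_ifs; exacts [PMF.apply_ne_top _ _, ENNReal.zero_ne_top]]
  refine Finset.sum_congr rfl fun s _ => ?_
  simp only [indexedVertex_eq_iff]
  split_ifs <;> rfl

open scoped Classical in
theorem contractedTo_toReal (x : IndexingState N Ψ) (j : IndexedVertex N Ψ) :
    contractedTo N Ψ x j.1 ≠ ⊤ ∧ (contractedTo N Ψ x j.1).toReal =
      ∑ y, if indexedVertex N Ψ y = j then contractedStep N Ψ x y else 0 := by
  constructor
  · refine ne_top_of_le_ne_top ENNReal.one_ne_top
      (le_trans (ENNReal.tsum_le_tsum fun y => ?_) (tsum_contracted_le_one (N := N) (Ψ := Ψ) x.1))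
    split_ifs
    exacts [le_rfl, zero_le]
  rw [contractedTo, tsum_eq_sum_subtype (p := fun s => Recurrent N Ψ s ∧ IsIncr Ψ s) fun t ht => by
    have ht' : contracted N Ψ x t ≠ 0 := fun h => ht (by rw [h, ite_self])
    exact ⟨x.2.1.of_reach (contracted_ne_zero ht').1, (contracted_ne_zero ht').2⟩,
    ENNReal.toReal_sum fun t _ => by
      split_ifs; exacts [contracted_ne_top _ _, ENNReal.zero_ne_top]]
  refine Finset.sum_congr rfl fun s _ => ?_
  simp only [indexedVertex_eq_iff]
  split_ifs <;> rfl

open scoped Classical in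
theorem impliedNetwork_eq_lump {ν : PMF (State R C)} (hν : IsContractedStationary N Ψ ν)
    (i j : IndexedVertex N Ψ) : impliedNetwork N Ψ ν i j =
      lump (contractedStep N Ψ) (fun s : IndexingState N Ψ => (ν s).toReal)
        (indexedVertex N Ψ) i j := by
  rw [impliedNetwork, ENNReal.toReal_div, tsum_vertex_toReal hν, lump]
  congr 1
  rw [tsum_eq_sum_subtype (p := fun s => Recurrent N Ψ s ∧ IsIncr Ψ s) fun t ht =>
    hν.1 t fun h => ht (by rw [h, zero_mul, ite_self]),
    ENNReal.toReal_sum fun t _ => by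
      split_ifs
      exacts [ENNReal.mul_ne_top (PMF.apply_ne_top _ _) (contractedTo_toReal t j).1,
        ENNReal.zero_ne_top]]
  refine Finset.sum_congr rfl fun s _ => ?_
  simp only [indexedVertex_eq_iff (s := s)]
  split_ifs
  · rw [ENNReal.toReal_mul, (contractedTo_toReal s j).2]
  · rfl

theorem impliedNetwork_eq_of_forall {ν : PMF (State R C)} (hν : IsContractedStationary N Ψ ν)
    (hpos : ∀ s : IndexingState N Ψ, 0 < (ν s).toReal) (i j : IndexedVertex N Ψ) (c : ℝ≥0∞)
    (hc : ∀ x : State R C, Recurrent N Ψ x → IsIncr Ψ x → x.vertex = some i.1 →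
      contractedTo N Ψ x j.1 = c) : impliedNetwork N Ψ ν i j = c.toReal := by
  classical
  have h1 : (∑' x : State R C, if x.vertex = some i.1 then ν x * contractedTo N Ψ x j.1 else 0) =
      (∑' x : State R C, if x.vertex = some i.1 then ν x else 0) * c := by
    rw [← ENNReal.tsum_mul_right]
    refine tsum_congr fun x => ?_
    split_ifs with hv
    · by_cases hx : ν x = 0
      · simp [hx]
      · rw [hc x (hν.1 x hx).1 (hν.1 x hx).2 hv]
    · simp
  have h2 := tsum_vertex_toReal hν i
  have h3 := marginal_pos hpos indexedVertex_surjective i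
  rw [← h2] at h3
  rw [impliedNetwork, h1, ENNReal.toReal_div, ENNReal.toReal_mul]
  field_simp

/-- A left eigenvector of a unichain matrix to the eigenvalue `1` is primary when its entries sum
to `1`. -/
theorem isPrimaryEigenvector_transpose {I : Type*} [Fintype I] {A : Matrix I I ℝ} {i₀ : I}
    (hA : IsUnichain A i₀) {p : I → ℝ} (hp : ∀ j, ∑ i, p i * A i j = p j) (h1 : ∑ i, p i = 1) :
    IsPrimaryEigenvector A.transpose p := by
  refine ⟨fun h0 => by simp [h0] at h1, 1, ?_, fun c z hz hc => ?_, fun y hy => ⟨∑ i, y i, ?_⟩⟩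
  · ext j
    simpa [Matrix.mulVec, dotProduct, mul_comm] using hp j
  · refine hA.norm_eigenvalue_le hz fun j => ?_
    simpa [Matrix.mulVec, dotProduct] using congrFun hc j
  · refine hA.stationary_unique (fun j => ?_) (fun j => ?_) ?_
    · simpa [Matrix.mulVec, dotProduct, mul_comm] using congrFun hy j
    · simp only [Pi.smul_apply, smul_eq_mul, mul_assoc, ← Finset.mul_sum, hp]
    · simp [← Finset.mul_sum, h1]

end Implied

/-! ### Almost sure behaviour of the walk -/

section Walk

variable {R C : Type*} [Fintype R] [Fintype C] {N : SemanticNetwork R} {Ψ : Grammar R C}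
  {Ω : Type*} [MeasurableSpace Ω] {P : Measure Ω} {X : ℕ → Ω → State R C}

/-- Almost surely the walk makes only steps of positive probability. -/
theorem IsWalk.ae_step_ne_zero (hX : IsWalk N Ψ P X) :
    ∀ᵐ ω ∂P, ∀ n, step N Ψ (X n ω) (X (n + 1) ω) ≠ 0 := by
  rw [ae_all_iff]
  intro n
  rw [ae_iff]
  -- the event is a countable union of cylinders, each with a vanishing last factor
  have hsub : {ω | ¬ step N Ψ (X n ω) (X (n + 1) ω) ≠ 0} ⊆
      ⋃ p : {p : Fin (n + 2) → State R C // step N Ψ (p ⟨n, by omega⟩) (p ⟨n + 1, by omega⟩) = 0},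
        {ω | ∀ k ≤ n + 1, X k ω = if hk : k < n + 2 then p.1 ⟨k, hk⟩ else none} := by
    intro ω hω
    refine Set.mem_iUnion.2 ⟨⟨fun k => X k ω, not_not.1 hω⟩, fun k hk => ?_⟩
    rw [dif_pos (by omega)]
  refine measure_mono_null hsub (measure_iUnion_null fun p => ?_)
  have h1 : n < n + 2 := by omega
  rw [hX.law n (fun k => if hk : k < n + 2 then p.1 ⟨k, hk⟩ else none)]
  simp [h1, p.2]

theorem reach_of_step_ne_zero {x : ℕ → State R C} (hstep : ∀ n, step N Ψ (x n) (x (n + 1)) ≠ 0)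
    {m n : ℕ} (h : m ≤ n) : Reach N Ψ (x m) (x n) := by
  induction n, h using Nat.le_induction with
  | base => exact Relation.ReflTransGen.refl
  | succ n _ ih => exact Relation.ReflTransGen.tail ih (hstep n)

variable [IsProbabilityMeasure P]

/-- Time averages along the walk. The walk is replaced by a process on the finitely many reachable
states that almost surely agrees with it. -/
theorem IsWalk.ae_tendsto_sum_div (hX : IsWalk N Ψ P X) {s₀ : ReachState N Ψ}
    (hU : IsUnichain (reachStep N Ψ) s₀) {f : State R C → ℝ} {c : ℝ} {g : ReachState N Ψ → ℝ}
    (hf : ∀ x : ReachState N Ψ, f x = c + (g x - ∑ y, reachStep N Ψ x y * g y)) :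
    ∀ᵐ ω ∂P, Tendsto (fun n : ℕ => (∑ k ∈ Finset.range n, f (X k ω)) / n) atTop (𝓝 c) := by
  classical
  let toReach : State R C → ReachState N Ψ := fun s =>
    if h : Reach N Ψ none s then ⟨s, h⟩ else ⟨none, Relation.ReflTransGen.refl⟩
  have hae : ∀ᵐ ω ∂P, ∀ n, (toReach (X n ω) : State R C) = X n ω := by
    filter_upwards [hX.start, hX.ae_step_ne_zero] with ω h0 hstep n
    have : Reach N Ψ none (X n ω) := h0 ▸ reach_of_step_ne_zero hstep (Nat.zero_le n)
    simp only [toReach, dif_pos this]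
  have hmX : ∀ n, @Measurable _ _ _ ⊤ (X n) := fun n => by
    let _ : MeasurableSpace (State R C) := ⊤
    exact measurable_to_countable' fun s => hX.measurable n s
  have hm : ∀ n s, MeasurableSet {ω | toReach (X n ω) = s} := fun n s =>
    hmX n (t := {x | toReach x = s}) trivial
  have hcyl : ∀ n (s : ℕ → ReachState N Ψ), P.real {ω | ∀ k ≤ n, toReach (X k ω) = s k} =
      P.real {ω | ∀ k ≤ n, X k ω = s k} := by
    intro n s
    refine measureReal_congr ?_
    filter_upwards [hae] with ω hω
    refine propext (forall₂_congr fun k _ => ?_)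
    rw [Subtype.ext_iff, hω k]
  have law : ∀ (n : ℕ) (s : ℕ → ReachState N Ψ),
      P.real {ω | ∀ k ≤ n + 1, toReach (X k ω) = s k} =
        P.real {ω | ∀ k ≤ n, toReach (X k ω) = s k} * reachStep N Ψ (s n) (s (n + 1)) := by
    intro n s
    rw [hcyl, hcyl, measureReal_def, hX.law n fun k => s k, ENNReal.toReal_mul]
    rfl
  filter_upwards [hae, tendsto_sum_div (Y := fun n ω => toReach (X n ω)) hm law hU.sum_one hf]
    with ω hω h
  simpa only [hω] using h

/-- Every recurrent state is visited infinitely often, because it has a positive frequency. -/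
theorem IsWalk.ae_frequently_eq (hX : IsWalk N Ψ P X) {s₀ : ReachState N Ψ}
    (hU : IsUnichain (reachStep N Ψ) s₀) {s : State R C} {c : ℝ} (hc : 0 < c)
    {g : ReachState N Ψ → ℝ} (hf : ∀ x : ReachState N Ψ,
      (Set.indicator {s} 1 (x : State R C) : ℝ) =
        c + (g x - ∑ y, reachStep N Ψ x y * g y)) :
    ∀ᵐ ω ∂P, ∃ᶠ n in atTop, X n ω = s := by
  filter_upwards [hX.ae_tendsto_sum_div hU hf] with ω h hnot
  obtain ⟨n₀, hn₀⟩ := eventually_atTop.1 hnot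
  have hconst : ∀ n ≥ n₀, ∑ k ∈ Finset.range n, (Set.indicator {s} 1 (X k ω) : ℝ) =
      ∑ k ∈ Finset.range n₀, (Set.indicator {s} 1 (X k ω) : ℝ) := by
    intro n hn
    induction n, hn using Nat.le_induction with
    | base => rfl
    | succ n hn ih => simp [Finset.sum_range_succ, ih, hn₀ n hn]
  have h0 := tendsto_const_div_atTop_nhds_zero_nat
    (∑ k ∈ Finset.range n₀, (Set.indicator {s} 1 (X k ω) : ℝ))
  have := tendsto_nhds_unique h (h0.congr' (by
    filter_upwards [eventually_ge_atTop n₀] with n hn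
    rw [hconst n hn]))
  exact hc.ne' this

end Walk

/-! ### Increments along grammatically correct paths -/

section Timing

variable {R C : Type*} {N : SemanticNetwork R} {Ψ : Grammar R C}

theorem IsSubmit.exists_context {s : State R C} (h : IsSubmit Ψ s) :
    ∃ l k c, s = some (l, k) ∧ s.context = some c ∧ Rule.submitCounts ∈ Ψ.rules c := by
  rcases s with _ | ⟨_ | ⟨v, l⟩, k⟩
  · exact absurd h (by simp [IsSubmit, State.rule])
  · exact absurd h (by simp [IsSubmit, State.rule])
  · exact ⟨v :: l, k, v.context, rfl, rfl, List.mem_of_getElem? h⟩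

variable [Fintype R] [Fintype C]

/-- At its rule number `k` the walker is in the context at which it arrived `k` rule executions
ago. -/
theorem exists_arrival {x : ℕ → State R C} (h0 : x 0 = none)
    (hstep : ∀ n, step N Ψ (x n) (x (n + 1)) ≠ 0) {n k : ℕ} {l : List (Visit R C)}
    (hn : x n = some (l, k)) : k ≤ n ∧ IsArrival (x (n - k)) ∧
      (x (n - k)).context = (x n).context := by
  have key : ∀ k n l, x n = some (l, k) → k ≤ n ∧ ∃ l', x (n - k) = some (l', 0) ∧
      l'.map Visit.context = l.map Visit.context := by
    intro k
    induction k with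
    | zero => exact fun n l hn => ⟨Nat.zero_le _, l, hn, rfl⟩
    | succ k ih =>
      intro n l hn
      cases n with
      | zero => simp [h0] at hn
      | succ n =>
        have hs := hstep n
        rw [hn] at hs
        rcases step_ne_zero hs with h | ⟨l', h, -⟩ | ⟨l₁, l₂, k', v, ha, hb, hl, -, -⟩
        · exact absurd h (Option.some_ne_none _)
        · simp at h
        · simp only [Option.some.injEq, Prod.mk.injEq, add_left_inj] at hb
          obtain ⟨rfl, rfl⟩ := hb
          obtain ⟨hk, l', h1, h2⟩ := ih n l₁ ha
          refine ⟨by omega, l', ?_, h2.trans hl.symm⟩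
          rwa [Nat.add_sub_add_right]
  obtain ⟨hk, l', h1, h2⟩ := key k n l hn
  refine ⟨hk, ⟨l', h1⟩, ?_⟩
  rw [h1, hn]
  change l'.head?.map Visit.context = l.head?.map Visit.context
  rw [← List.head?_map, ← List.head?_map, h2]

/-- A walk that comes back to a submitting state again and again and has ceased to halt moves on
grammatically correct paths: they start at the arrival in a context where counts are submitted, and
end at any later visit to the submitting state. -/
theorem exists_forall_pathLength_eq {L : ℕ} (hL : EqualLengths N Ψ L) {x : ℕ → State R C}
    (h0 : x 0 = none) (hstep : ∀ n, step N Ψ (x n) (x (n + 1)) ≠ 0) {n₀ : ℕ}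
    (hne : ∀ n ≥ n₀, x n ≠ none) {s : State R C} (hs : IsSubmit Ψ s)
    (hfreq : ∃ᶠ n in atTop, x n = s) :
    ∃ n₁, ∀ a b, n₁ ≤ a → ConsecutiveIncr Ψ x a b → pathLength x a b = L := by
  obtain ⟨l, k, c, hlk, hc, hmem⟩ := hs.exists_context
  obtain ⟨n, hn, hns⟩ := frequently_atTop.1 hfreq (n₀ + k)
  obtain ⟨hk, harr, hctx⟩ := exists_arrival h0 hstep (hns.trans hlk)
  refine ⟨n - k, fun a b ha hab => ?_⟩
  obtain ⟨n', hn', hns'⟩ := frequently_atTop.1 hfreq b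
  have hab' := hab.1
  refine hL x (n - k) n' ⟨by omega, ?_, fun k _ _ => hstep k, fun j hj _ => hne j (by omega),
    ⟨harr, c, by rw [hctx, hns, hc], Or.inr hmem⟩, ⟨c, by rw [hns', hc], hmem⟩,
    a, ha, by omega, hab.2.1⟩ a b ha hn' hab
  exact h0 ▸ reach_of_step_ne_zero hstep (Nat.zero_le _)

end Timing

/-! ### Normalized counts -/

section Counts

open scoped Classical in
/-- The indicator of the states at which the vertex `i` is indexed. -/
noncomputable def incrAt {R C : Type*} (Ψ : Grammar R C) (i : R) (s : State R C) : ℝ :=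
  if IsIncr Ψ s ∧ s.vertex = some i then 1 else 0

/-- The counts of `i` that the walker holds or has submitted. -/
noncomputable def totalCount {R C : Type*} (Ψ : Grammar R C) (x : ℕ → State R C) (n : ℕ) (i : R) :
    ℝ :=
  (counts Ψ x n).1 i + (counts Ψ x n).2 i

variable {R C : Type*} {Ψ : Grammar R C} {x : ℕ → State R C}

theorem totalCount_succ {n : ℕ} (hn : x n ≠ none) (i : R) :
    totalCount Ψ x (n + 1) i = totalCount Ψ x n i + incrAt Ψ i (x n) := by
  classical
  simp only [totalCount, incrAt, counts]
  by_cases h1 : IsIncr Ψ (x n)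
  · by_cases h2 : (x n).vertex = some i
    · simp [h1, h2]; ring
    · simp [h1, h2]
  · by_cases h2 : IsSubmit Ψ (x n)
    · simp [h1, h2]; ring
    · simp [h1, h2, hn]

/-- After a submission at a time `t` without later halts, the submitted counts are the total counts as
of some time after `t`, namely just after the latest submission. -/
theorem exists_submitted_eq_totalCount {n₀ t : ℕ} (hne : ∀ n ≥ n₀, x n ≠ none) (ht : n₀ ≤ t)
    (hs : IsSubmit Ψ (x t)) {n : ℕ} (hn : t + 1 ≤ n) :
    ∃ m ≥ t + 1, ∀ i, ((counts Ψ x n).2 i : ℝ) = totalCount Ψ x m i := by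
  classical
  have hnot : ∀ {n}, IsSubmit Ψ (x n) → ¬ IsIncr Ψ (x n) := fun h h' => by
    rw [IsIncr, show (x _).rule Ψ = some .submitCounts from h] at h'
    simp at h'
  have hsubmit : ∀ {n}, IsSubmit Ψ (x n) →
      ∀ i, ((counts Ψ x (n + 1)).2 i : ℝ) = totalCount Ψ x (n + 1) i := fun h i => by
    simp [totalCount, counts, hnot h, h]
  induction n, hn using Nat.le_induction with
  | base => exact ⟨t + 1, le_rfl, hsubmit hs⟩
  | succ n hn ih =>
    by_cases h : IsSubmit Ψ (x n)
    · exact ⟨n + 1, by omega, hsubmit h⟩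
    · obtain ⟨m, hm, hmi⟩ := ih
      refine ⟨m, hm, fun i => ?_⟩
      rw [← hmi]
      simp only [counts, h, hne n (by omega), if_false]
      split_ifs <;> rfl

/-- The normalized counts are those at the latest submission, and the counts lost in the beginning are
negligible, so that they converge to the relative frequencies of the increments. -/
theorem tendsto_normalizedCount [Fintype R] {n₀ : ℕ} (hne : ∀ n ≥ n₀, x n ≠ none)
    (hsub : ∃ᶠ n in atTop, IsSubmit Ψ (x n)) {c : R → ℝ}
    (hc : ∀ i, Tendsto (fun n : ℕ => (∑ k ∈ Finset.range n, incrAt Ψ i (x k)) / n) atTop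
      (𝓝 (c i))) (hpos : ∑ j, c j ≠ 0) (i : R) :
    Tendsto (fun n => normalizedCount Ψ x n i) atTop (𝓝 (c i / ∑ j, c j)) := by
  have htot : ∀ i, Tendsto (fun n : ℕ => totalCount Ψ x n i / n) atTop (𝓝 (c i)) := by
    intro i
    have hconst : ∀ n ≥ n₀, totalCount Ψ x n i = ∑ k ∈ Finset.range n, incrAt Ψ i (x k) +
        (totalCount Ψ x n₀ i - ∑ k ∈ Finset.range n₀, incrAt Ψ i (x k)) := by
      intro n hn
      induction n, hn using Nat.le_induction with
      | base => ring
      | succ n hn ih =>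
        rw [totalCount_succ (hne n hn), ih, Finset.sum_range_succ]; ring
    have h := (hc i).add (tendsto_const_div_atTop_nhds_zero_nat
      (totalCount Ψ x n₀ i - ∑ k ∈ Finset.range n₀, incrAt Ψ i (x k)))
    rw [add_zero] at h
    refine h.congr' ?_
    filter_upwards [eventually_ge_atTop n₀] with n hn
    rw [hconst n hn, add_div]
  have hratio : Tendsto (fun n : ℕ => totalCount Ψ x n i / ∑ j, totalCount Ψ x n j) atTop
      (𝓝 (c i / ∑ j, c j)) := by
    refine ((htot i).div (tendsto_finsetSum _ fun j _ => htot j) hpos).congr' ?_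
    filter_upwards [eventually_ge_atTop 1] with n hn
    have : (n : ℝ) ≠ 0 := by positivity
    rw [Pi.div_apply, ← Finset.sum_div, div_div_div_cancel_right₀ this]
  intro U hU
  obtain ⟨M, hM⟩ := eventually_atTop.1 (hratio.eventually_mem hU)
  obtain ⟨t, ht, hts⟩ := frequently_atTop.1 hsub (max n₀ M)
  refine mem_map.2 (mem_atTop_sets.2 ⟨t + 1, fun n hn => ?_⟩)
  obtain ⟨m, hm, hmi⟩ := exists_submitted_eq_totalCount hne ((le_max_left _ _).trans ht) hts hn
  have := hM m (by have := le_max_right n₀ M; omega)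
  simpa only [Set.mem_preimage, normalizedCount, hmi] using this

end Counts

end GrammarWalk

open GrammarWalk
theorem theorem2 {R C : Type*} [Fintype R] [Fintype C]
    (N : SemanticNetwork R) (Ψ : Grammar R C)
    (hconn : StronglyConnected N Ψ) (hcorr : LongRunCorrect N Ψ)
    (L : ℕ) (hL : EqualLengths N Ψ L)
    {Ω : Type*} [MeasurableSpace Ω] (P : MeasureTheory.Measure Ω)
    [MeasureTheory.IsProbabilityMeasure P]
    (X : ℕ → Ω → State R C) (hX : IsWalk N Ψ P X) :
    -- the timing between indexing is unaffected by the contraction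
    (∀ᵐ ω ∂P, ∃ n₀, ∀ a b, n₀ ≤ a → ConsecutiveIncr Ψ (fun n => X n ω) a b →
      pathLength (fun n => X n ω) a b = L) ∧
    -- the contracted network is a Markov chain
    (∀ x, Recurrent N Ψ x → IsIncr Ψ x → ∑' y, contracted N Ψ x y = 1) ∧
    ∃ ν : PMF (State R C),
      IsContractedStationary N Ψ ν ∧ (∀ ν', IsContractedStationary N Ψ ν' → ν' = ν) ∧
      -- the implied network on the indexed vertices is a Markov chain, and its weights are the
      -- branch probabilities wherever these depend on the vertex only
      (∀ i j, 0 ≤ impliedNetwork N Ψ ν i j) ∧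
      (∀ i, ∑ j, impliedNetwork N Ψ ν i j = 1) ∧
      (∀ (i j : IndexedVertex N Ψ) (c : ENNReal),
        (∀ x : State R C, Recurrent N Ψ x → IsIncr Ψ x → x.vertex = some i.1 →
          contractedTo N Ψ x j.1 = c) → impliedNetwork N Ψ ν i j = c.toReal) ∧
      -- the normalized counts converge to the primary eigenvector of the implied network
      ∃ π' : IndexedVertex N Ψ → ℝ,
        (∀ᵐ ω ∂P, ∀ i, Filter.Tendsto (fun n => normalizedCount Ψ (fun n => X n ω) n i.1)
          Filter.atTop (nhds (π' i))) ∧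
        (∀ i, 0 < π' i) ∧ ∑ i, π' i = 1 ∧
        IsPrimaryEigenvector (impliedNetwork N Ψ ν).transpose π' := by
  classical
  obtain ⟨hnone, ⟨s₀, hs₀, hi₀⟩, s₁, hs₁, hsub⟩ := hcorr
  have hU := isUnichain_reachStep hconn hs₀
  obtain ⟨ν, Z, hZ, hν, hνpos, hP, hrec⟩ :=
    exists_isContractedStationary hconn (⟨s₀, hs₀, hi₀⟩ : IndexingState N Ψ)
  -- almost surely the walk comes back to `s₁` again and again, and so it ceases to halt
  have hfreq : ∀ᵐ ω ∂P, ∃ᶠ n in Filter.atTop, X n ω = s₁ := by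
    obtain ⟨c, g, hc, hg⟩ := hrec s₁ hs₁
    exact hX.ae_frequently_eq hU hc hg
  have hne : ∀ᵐ ω ∂P, ∃ n₀, ∀ n ≥ n₀, X n ω ≠ none := by
    filter_upwards [hfreq, hX.ae_step_ne_zero] with ω hω hstep
    obtain ⟨n₀, hn₀⟩ := hω.exists
    refine ⟨n₀, fun n hn h => hnone ?_⟩
    rw [← h]
    exact (hn₀ ▸ hs₁ : Recurrent N Ψ (X n₀ ω)).of_reach (reach_of_step_ne_zero hstep hn)
  have hK := isUnichain_contractedStep hconn (⟨s₀, hs₀, hi₀⟩ : IndexingState N Ψ)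
  have hA : FiniteChain.IsUnichain (impliedNetwork N Ψ ν) (indexedVertex N Ψ ⟨s₀, hs₀, hi₀⟩) := by
    have : impliedNetwork N Ψ ν = FiniteChain.lump (contractedStep N Ψ)
        (fun s : IndexingState N Ψ => (ν s).toReal) (indexedVertex N Ψ) :=
      funext₂ fun i j => impliedNetwork_eq_lump hν i j
    rw [this]
    exact hK.lump hνpos indexedVertex_surjective
  refine ⟨?_, fun x hx _ => tsum_contracted_eq_one hconn hs₀ hi₀ hx.1, ν, hν,
    fun ν' hν' => hν.unique hconn ⟨s₀, hs₀, hi₀⟩ hν', hA.nonneg, hA.sum_one,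
    impliedNetwork_eq_of_forall hν hνpos,
    FiniteChain.marginal (fun s : IndexingState N Ψ => (ν s).toReal) (indexedVertex N Ψ),
    ?_, FiniteChain.marginal_pos hνpos indexedVertex_surjective, ?_,
    isPrimaryEigenvector_transpose hA (fun j => ?_) ?_⟩
  · filter_upwards [hX.start, hX.ae_step_ne_zero, hfreq, hne] with ω h0 hstep hω ⟨n₀, hn₀⟩
    exact exists_forall_pathLength_eq hL h0 hstep hn₀ hsub hω
  · -- the frequency of the increments at `i`
    let c : R → ℝ := fun i => Z * ∑ s : IndexingState N Ψ, (ν s).toReal * incrAt Ψ i s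
    have hlim : ∀ᵐ ω ∂P, ∀ i, Filter.Tendsto (fun n : ℕ =>
        (∑ k ∈ Finset.range n, incrAt Ψ i (X k ω)) / n) Filter.atTop (𝓝 (c i)) := by
      rw [MeasureTheory.ae_all_iff]
      intro i
      obtain ⟨g, hg⟩ := hP (incrAt Ψ i) fun s hs => by
        by_contra h
        exact hs (if_neg fun h' => h h'.1)
      exact hX.ae_tendsto_sum_div hU hg
    have hsum : ∑ i, c i = Z := by
      have h1 : ∀ s : IndexingState N Ψ, ∑ i, incrAt Ψ i (s : State R C) = 1 := fun s => by
        obtain ⟨j, hj⟩ := s.2.2.exists_vertex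
        simp [incrAt, s.2.2, hj]
      simp only [c]
      rw [← Finset.mul_sum, Finset.sum_comm]
      simp only [← Finset.mul_sum, h1, mul_one, hν.sum_eq_one]
    have hci : ∀ i : IndexedVertex N Ψ, c i.1 / ∑ j, c j = FiniteChain.marginal
        (fun s : IndexingState N Ψ => (ν s).toReal) (indexedVertex N Ψ) i := fun i => by
      rw [hsum, mul_div_cancel_left₀ _ hZ.ne']
      refine Finset.sum_congr rfl fun s _ => ?_
      simp [incrAt, s.2.2, indexedVertex_eq_iff]
    filter_upwards [hlim, hne, hfreq] with ω hω ⟨n₀, hn₀⟩ hf i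
    rw [← hci]
    exact tendsto_normalizedCount hn₀ (hf.mono fun n hn => hn ▸ hsub) hω (hsum ▸ hZ.ne') i.1
  · rw [FiniteChain.sum_marginal, hν.sum_eq_one]
  · simp only [impliedNetwork_eq_lump hν]
    exact FiniteChain.marginal_mul_lump hνpos hν.sum_mul_contractedStep indexedVertex_surjective j
  · rw [FiniteChain.sum_marginal, hν.sum_eq_one]
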